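/- Let $\rho$ be a quantum state in dimension $d$, i.e. a positive semidefinite $d\times d$ complex matrix of unit trace. Let $\mathrm{d}v$ be the unitarily invariant probability measure on the unit sphere $\mathbb{S}^d\subset\mathbb{C}^d$. Perform $n\ge 1$ independent measurements of the uniform POVM $\{d\,|v\rangle\langle v|\,\mathrm{d}v\}_{v\in\mathbb{S}^d}$ on copies of $\rho$: the outcomes $v_1,\dots,v_n$ are i.i.d. with law $d\,\langle v|\rho|v\rangle\,\mathrm{d}v$. Let $\hat L_n$ be the least-squares estimator, i.e. the hermitian matrix $X$ that minimizes $$\int_{\mathbb{S}^d}\big(d\langle v|X|v\rangle\big)^2\,\mathrm{d}v-\frac{2}{n}\sum_{i=1}^n d\langle v_i|X|v_i\rangle .$$ (This is the squared distance between the empirical distribution and the density $v\mapsto d\langle v|X|v\rangle$ predicted by Born's rule, without the term that does not depend on $X$.) Let the projected least-squares (PLS) estimator $\hat\rho_n$ be the quantum state closest to $\hat L_n$ in Frobenius norm. Put $\hat r=\min\{\mathrm{rank}(\rho),\mathrm{rank}(\hat\rho_n)\}$, and let $\|\cdot\|_1$ be the trace norm. 1. For every $t>0$, $$\Pr\big[\|\hat\rho_n-\rho\|_1\ge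 \hat r\,t\big]\le \exp\Big(2.2\,d-\frac{t^2 n}{480}\Big).$$ Also, for every $\epsilon>0$ and every integer $r\ge1$, $$\Pr\big[\|\hat\rho_n-\rho\|_1\ge\epsilon\ \text{ and }\ \hat r\le r\big]\le\exp\Big(2.2\,d-\frac{\epsilon^2 n}{480\,r^2}\Big).$$ 2. There is a universal constant $C>0$ such that for all $d$, $n$, $\rho$ as above, all $\epsilon>0$ and all $0<\delta\le\frac12$: if $n\ge C\,\dfrac{\mathrm{rank}(\rho)^2\,d}{\epsilon^2}\log(1/\delta)$, then $\|\hat\rho_n-\rho\|_1\le\epsilon$ with probability at least $1-\delta$. -/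

import Mathlib

open MeasureTheory ProbabilityTheory
open scoped ComplexOrder

noncomputable section

namespace PLS

/-- The complex unit sphere of `ℂ^d`. -/
abbrev Sphere (d : ℕ) : Type := Metric.sphere (0 : EuclideanSpace ℂ (Fin d)) 1

/-- The uniform probability measure on the complex unit sphere: the normalized surface measure. -/
def uniformMeasure (d : ℕ) : Measure (Sphere d) :=
  ((volume : Measure (EuclideanSpace ℂ (Fin d))).toSphere Set.univ)⁻¹ •
    (volume : Measure (EuclideanSpace ℂ (Fin d))).toSphere

/-- Helper fact: the uniform measure is a probability measure. -/
theorem isProbabilityMeasure_uniformMeasure (d : ℕ) (hd : 0 < d) :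
    IsProbabilityMeasure (uniformMeasure d) := by
  have : Nonempty (Fin d) := ⟨⟨0, hd⟩⟩
  have h : (volume : Measure (EuclideanSpace ℂ (Fin d))).toSphere ≠ 0 :=
    Measure.toSphere_ne_zero _
  constructor
  rw [uniformMeasure, Measure.smul_apply, smul_eq_mul]
  exact ENNReal.inv_mul_cancel (Measure.measure_univ_ne_zero.2 h) (measure_ne_top _ _)

/-- The action of a unitary map of `ℂ^d` on the complex unit sphere. -/
def unitaryAct {d : ℕ} (U : EuclideanSpace ℂ (Fin d) ≃ₗᵢ[ℂ] EuclideanSpace ℂ (Fin d))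
    (v : Sphere d) : Sphere d :=
  ⟨U v, by simp⟩

/-- Helper fact: the uniform measure is unitarily invariant. -/
theorem map_unitaryAct_uniformMeasure {d : ℕ}
    (U : EuclideanSpace ℂ (Fin d) ≃ₗᵢ[ℂ] EuclideanSpace ℂ (Fin d)) :
    (uniformMeasure d).map (unitaryAct U) = uniformMeasure d := by
  have hm : Measurable (unitaryAct U) := by
    refine Measurable.subtype_mk ?_
    exact U.continuous.measurable.comp measurable_subtype_coe
  ext s hs
  rw [Measure.map_apply hm hs, uniformMeasure, Measure.smul_apply, Measure.smul_apply,
    Measure.toSphere_apply' _ (hm hs), Measure.toSphere_apply' _ hs]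
  congr 2
  have hU : MeasurePreserving
      (U : EuclideanSpace ℂ (Fin d) → EuclideanSpace ℂ (Fin d)) volume volume :=
    LinearIsometryEquiv.measurePreserving
      (⟨U.toLinearEquiv.restrictScalars ℝ, U.norm_map⟩ :
        EuclideanSpace ℂ (Fin d) ≃ₗᵢ[ℝ] EuclideanSpace ℂ (Fin d))
  refine Eq.trans ?_ (hU.measure_preimage_emb U.toHomeomorph.measurableEmbedding _)
  have hsmul : ∀ (r : ℝ) (x : EuclideanSpace ℂ (Fin d)), U (r • x) = r • U x := fun r x =>
    U.toLinearEquiv.toLinearMap.map_smul_of_tower r x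
  congr 1
  ext x
  simp only [Set.mem_smul, Set.mem_image, Set.mem_preimage]
  constructor
  · rintro ⟨r, hr, _, ⟨v, hv, rfl⟩, rfl⟩
    exact ⟨r, hr, _, ⟨unitaryAct U v, hv, rfl⟩, by simp [unitaryAct, hsmul]⟩
  · rintro ⟨r, hr, _, ⟨w, hw, rfl⟩, h⟩
    have hw' : unitaryAct U (unitaryAct U.symm w) = w := by
      apply Subtype.ext
      simp [unitaryAct]
    refine ⟨r, hr, _, ⟨unitaryAct U.symm w, by rwa [hw'], rfl⟩, ?_⟩
    apply U.injective
    rw [← h]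
    simp [unitaryAct, hsmul]

/-- Quantum states: positive semidefinite matrices of unit trace. -/
def IsState {d : ℕ} (ρ : Matrix (Fin d) (Fin d) ℂ) : Prop :=
  ρ.PosSemidef ∧ ρ.trace = 1

/-- The measurement map `X ↦ (v ↦ d ⟨v|X|v⟩)` of the uniform POVM `{d |v⟩⟨v| dv}`. The number
`⟨v|X|v⟩` is real for hermitian `X`. -/
def measurement {d : ℕ} (X : Matrix (Fin d) (Fin d) ℂ) (v : Sphere d) : ℝ :=
  d * (star (v : EuclideanSpace ℂ (Fin d)).ofLp ⬝ᵥ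
    X.mulVec (v : EuclideanSpace ℂ (Fin d)).ofLp).re

/-- Born's rule for the uniform POVM: measuring the state `ρ` yields the outcome `v` with
probability `d ⟨v|ρ|v⟩ dv`. -/
def bornMeasure {d : ℕ} (ρ : Matrix (Fin d) (Fin d) ℂ) : Measure (Sphere d) :=
  (uniformMeasure d).withDensity fun v => ENNReal.ofReal (measurement ρ v)

/-- `v 0, …, v (n - 1)` are the outcomes of `n` independent uniform POVM measurements, each of
them performed on a separate copy of `ρ`. -/
structure IsUniformPOVMSample {d n : ℕ} {Ω : Type*} [MeasurableSpace Ω]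
    (ρ : Matrix (Fin d) (Fin d) ℂ) (P : Measure Ω) (v : Fin n → Ω → Sphere d) : Prop where
  indep : iIndepFun v P
  law : ∀ i, HasLaw (v i) (bornMeasure ρ) P

/-- The least-squares objective for the data `v`. With `f` the empirical measure of the data, it is
the expansion of `∫ (f - measurement X)² dv` without the term that does not depend on `X`. -/
def leastSquaresObjective {d n : ℕ} (v : Fin n → Sphere d) (X : Matrix (Fin d) (Fin d) ℂ) : ℝ :=
  (∫ w, measurement X w ^ 2 ∂(uniformMeasure d)) - 2 * ((1 / n : ℝ) * ∑ i, measurement X (v i))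

/-- `L` is the least-squares estimator for the data `v`: it minimizes the least-squares objective
over all hermitian matrices. -/
def IsLeastSquares {d n : ℕ} (v : Fin n → Sphere d) (L : Matrix (Fin d) (Fin d) ℂ) : Prop :=
  L.IsHermitian ∧ ∀ X : Matrix (Fin d) (Fin d) ℂ, X.IsHermitian →
    leastSquaresObjective v L ≤ leastSquaresObjective v X

section

attribute [local instance] Matrix.frobeniusNormedAddCommGroup

/-- The Frobenius norm. -/
def frobeniusNorm {d : ℕ} (A : Matrix (Fin d) (Fin d) ℂ) : ℝ := ‖A‖

end

/-- The trace norm: the sum of the singular values. -/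
def traceNorm {d : ℕ} (A : Matrix (Fin d) (Fin d) ℂ) : ℝ :=
  ∑ i, Real.sqrt ((Matrix.isHermitian_conjTranspose_mul_self A).eigenvalues i)

/-- `σ` is a quantum state closest to `L` in Frobenius norm. -/
def IsStateProjection {d : ℕ} (L σ : Matrix (Fin d) (Fin d) ℂ) : Prop :=
  IsState σ ∧ ∀ τ : Matrix (Fin d) (Fin d) ℂ, IsState τ →
    frobeniusNorm (L - σ) ≤ frobeniusNorm (L - τ)

/-- `σ` is the projected least-squares estimator for the data `v`. -/
def IsPLSEstimator {d n : ℕ} (v : Fin n → Sphere d) (σ : Matrix (Fin d) (Fin d) ℂ) : Prop :=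
  ∃ L : Matrix (Fin d) (Fin d) ℂ, IsLeastSquares v L ∧ IsStateProjection L σ

end PLS

end

open MeasureTheory ProbabilityTheory
open scoped ComplexOrder

noncomputable section

namespace PLS

/-! In dimension D, stationarity of the least-squares objective in the direction |z⟩⟨z| shows that
⟨z|L|z⟩ + 1 is the empirical mean of (D+1)|⟨z,v_i⟩|² (`IsLeastSquares.quad_eq`). Under Born's rule
each summand has mean 1 + ⟨z|ρ|z⟩, and exact sphere moments give it a sub-exponential tail with
constants free of D (`integral_exp_centered_le`). A Chernoff bound for each z and a union bound over
a 1/4-net of at most 81^D unit vectors control the operator norm m of L - ρ.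

Two deterministic facts lead from there to the trace norm. Projecting onto the states at most
doubles the operator-norm error (`IsStateProjection.abs_quad_sub_le`), by duality. A difference of
two states has trace zero and at most as many positive eigenvalues as the rank of the first, so its
trace norm is at most twice that rank times its operator norm; by symmetry the smaller rank serves
(`traceNorm_sub_le_min_rank`). Hence the trace-norm error is at most 4m times the smaller rank for
every outcome, and the randomness of that rank is harmless.

Most lemmas use `Fin (d + 1)` to exclude dimension zero, so D + 1 appears there as d + 2. -/

/-! ### Gaussian integrals and moments on the complex sphere -/

open Set in
/-- Integration in polar coordinates of a function that separates into an angular and a radial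
part. -/
theorem integral_eq_toSphere_mul_integral_Ioi {E : Type*} [NormedAddCommGroup E] [NormedSpace ℝ E]
    [MeasurableSpace E] [BorelSpace E] [FiniteDimensional ℝ E] [Nontrivial E]
    (μ : Measure E) [μ.IsAddHaarMeasure] (f : E → ℝ) (h : Metric.sphere (0 : E) 1 → ℝ) (g : ℝ → ℝ)
    (hf : ∀ (r : ℝ) (v : Metric.sphere (0 : E) 1), 0 < r → f (r • (v : E)) = h v * g r) :
    ∫ x, f x ∂μ = (∫ v, h v ∂μ.toSphere) *
      ∫ y in Ioi (0 : ℝ), y ^ (Module.finrank ℝ E - 1) * g y :=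
  calc
    ∫ x, f x ∂μ = ∫ x : ({(0)}ᶜ : Set E), f x.1 ∂(μ.comap (↑)) := by
      rw [integral_subtype_comap (measurableSet_singleton _).compl fun x ↦ f x,
        restrict_compl_singleton]
    _ = ∫ x, h x.1 * g x.2 ∂μ.toSphere.prod (.volumeIoiPow (Module.finrank ℝ E - 1)) := by
      rw [← μ.measurePreserving_homeomorphUnitSphereProd.integral_comp
        (Homeomorph.measurableEmbedding _)]
      refine integral_congr_ae (.of_forall fun x => ?_)
      have hx : (x : E) ≠ 0 := x.2
      have hx' : 0 < ‖(x : E)‖ := norm_pos_iff.2 hx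
      have := hf ‖(x : E)‖ (homeomorphUnitSphereProd E x).1 hx'
      simp only [homeomorphUnitSphereProd_apply_fst_coe] at this
      rw [smul_smul, mul_inv_cancel₀ hx'.ne', one_smul] at this
      simpa using this
    _ = (∫ v, h v ∂μ.toSphere) * ∫ x : Ioi (0 : ℝ), g x ∂.volumeIoiPow (Module.finrank ℝ E - 1) :=
      integral_prod_mul h (fun x : Ioi (0 : ℝ) => g x)
    _ = _ := by
      congr 1
      simp only [Measure.volumeIoiPow, ENNReal.ofReal]
      rw [integral_withDensity_eq_integral_smul,
        integral_subtype_comap measurableSet_Ioi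
          fun a ↦ Real.toNNReal (a ^ (Module.finrank ℝ E - 1)) • g a,
        setIntegral_congr_fun measurableSet_Ioi fun x hx ↦ ?_]
      · rw [NNReal.smul_def, Real.coe_toNNReal _ (pow_nonneg hx.out.le _), smul_eq_mul]
      · exact (measurable_subtype_coe.pow_const _).real_toNNReal

theorem integral_pow_mul_exp_neg_sq (n : ℕ) :
    ∫ y in Set.Ioi (0 : ℝ), y ^ (2 * n + 1) * Real.exp (-y ^ 2) = n.factorial / 2 := by
  have := integral_rpow_mul_exp_neg_rpow (p := 2) (q := (2 * n + 1 : ℕ)) two_pos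
    (lt_of_lt_of_le (by norm_num) (Nat.cast_nonneg _))
  simp only [Real.rpow_natCast, Real.rpow_two] at this
  rw [this]
  have : (((2 * n + 1 : ℕ) : ℝ) + 1) / 2 = n + 1 := by push_cast; ring
  rw [this, Real.Gamma_nat_eq_factorial]
  ring

theorem complex_integral_pow_mul_exp_neg_sq (n : ℕ) :
    ∫ w : ℂ, ‖w‖ ^ (2 * n) * Real.exp (-‖w‖ ^ 2) = Real.pi * n.factorial := by
  have := Complex.integral_rpow_mul_exp_neg_rpow (p := 2) (q := (2 * n : ℕ)) one_le_two
    (lt_of_lt_of_le (by norm_num) (Nat.cast_nonneg _))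
  simp only [Real.rpow_natCast, Real.rpow_two] at this
  rw [this]
  have : (((2 * n : ℕ) : ℝ) + 2) / 2 = n + 1 := by push_cast; ring
  rw [this, Real.Gamma_nat_eq_factorial]
  ring

/-- The Gaussian integral of a monomial in the squared moduli of the coordinates, up to a
normalization that does not depend on the monomial. -/
theorem exists_integral_prod_mul_exp (d : ℕ) :
    ∃ c : ℝ, ∀ k : Fin d → ℕ,
      ∫ x : EuclideanSpace ℂ (Fin d), (∏ i, ‖x i‖ ^ (2 * k i)) * Real.exp (-‖x‖ ^ 2) =
        c * ∏ i, ((k i).factorial : ℝ) := by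
  let e : EuclideanSpace ℂ (Fin d) ≃L[ℝ] (Fin d → ℂ) :=
    PiLp.continuousLinearEquiv 2 ℝ (fun _ : Fin d => ℂ)
  let μ : Measure (Fin d → ℂ) := Measure.map e volume
  have hμ : μ.IsAddHaarMeasure := e.isAddHaarMeasure_map volume
  obtain ⟨s, hs⟩ : ∃ s : NNReal, μ = s • (volume : Measure (Fin d → ℂ)) :=
    ⟨_, Measure.isAddLeftInvariant_eq_smul μ volume⟩
  refine ⟨(s : ℝ) * Real.pi ^ d, fun k => ?_⟩
  have h2 : ∀ x : EuclideanSpace ℂ (Fin d),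
      (∏ i, ‖x i‖ ^ (2 * k i)) * Real.exp (-‖x‖ ^ 2) =
        (fun y : Fin d → ℂ => ∏ i, (‖y i‖ ^ (2 * k i) * Real.exp (-‖y i‖ ^ 2))) (e x) := by
    intro x
    change _ = ∏ i, (‖x i‖ ^ (2 * k i) * Real.exp (-‖x i‖ ^ 2))
    rw [Finset.prod_mul_distrib, ← Real.exp_sum, EuclideanSpace.norm_sq_eq, Finset.sum_neg_distrib]
  simp_rw [h2]
  refine (e.toHomeomorph.measurableEmbedding.integral_map
    (fun y : Fin d → ℂ => ∏ i, (‖y i‖ ^ (2 * k i) * Real.exp (-‖y i‖ ^ 2)))).symm.trans ?_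
  change ∫ y, _ ∂μ = _
  rw [hs, integral_smul_nnreal_measure, integral_fintype_prod_volume_eq_prod
    (f := fun i (w : ℂ) => ‖w‖ ^ (2 * k i) * Real.exp (-‖w‖ ^ 2))]
  simp_rw [complex_integral_pow_mul_exp_neg_sq, Finset.prod_mul_distrib]
  simp [NNReal.smul_def, mul_assoc]

/-- One Gaussian integral is computed twice: it factors over the coordinates, and in polar
coordinates it is the spherical integral times the radial factor (d + ∑ k)!/2. -/
theorem integral_prod_toSphere (d : ℕ) :
    ∃ c : ℝ, ∀ k : Fin (d + 1) → ℕ,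
      ∫ v : Sphere (d + 1), ∏ i, ‖v.1 i‖ ^ (2 * k i)
        ∂(volume : Measure (EuclideanSpace ℂ (Fin (d + 1)))).toSphere =
        c * (∏ i, ((k i).factorial : ℝ)) / (d + ∑ i, k i).factorial := by
  obtain ⟨c, hc⟩ := exists_integral_prod_mul_exp (d + 1)
  refine ⟨c * 2, fun k => ?_⟩
  have h := integral_eq_toSphere_mul_integral_Ioi
    (volume : Measure (EuclideanSpace ℂ (Fin (d + 1))))
    (fun x => (∏ i, ‖x i‖ ^ (2 * k i)) * Real.exp (-‖x‖ ^ 2))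
    (fun v => ∏ i, ‖v.1 i‖ ^ (2 * k i)) (fun r => r ^ (2 * ∑ i, k i) * Real.exp (-r ^ 2))
    (by
      intro r v hr
      have hv : ‖(v : EuclideanSpace ℂ (Fin (d + 1)))‖ = 1 := by simp
      simp only [PiLp.smul_apply, norm_smul, hv, Real.norm_eq_abs, abs_of_pos hr, mul_one, mul_pow,
        Finset.prod_mul_distrib, Finset.prod_pow_eq_pow_sum, Finset.mul_sum]
      ring)
  rw [hc] at h
  have hfin : Module.finrank ℝ (EuclideanSpace ℂ (Fin (d + 1))) = 2 * (d + 1) := by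
    rw [finrank_real_of_complex, finrank_euclideanSpace_fin]
  have h3 : ∫ y in Set.Ioi (0 : ℝ), y ^ (Module.finrank ℝ (EuclideanSpace ℂ (Fin (d + 1))) - 1) *
      (y ^ (2 * ∑ i, k i) * Real.exp (-y ^ 2)) = (d + ∑ i, k i).factorial / 2 := by
    rw [← integral_pow_mul_exp_neg_sq, hfin]
    congr 1
    ext y
    rw [← mul_assoc, ← pow_add]
    congr 2
    omega
  rw [h3] at h
  have : ((d + ∑ i, k i).factorial : ℝ) ≠ 0 := by positivity
  rw [eq_div_iff this, mul_right_comm, h]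
  ring

/-- Moments of the squared moduli of the coordinates under the uniform measure on the complex
sphere. -/
theorem integral_prod_uniformMeasure (d : ℕ) (k : Fin (d + 1) → ℕ) :
    ∫ v : Sphere (d + 1), ∏ i, ‖v.1 i‖ ^ (2 * k i) ∂(uniformMeasure (d + 1)) =
      (∏ i, ((k i).factorial : ℝ)) * d.factorial / (d + ∑ i, k i).factorial := by
  obtain ⟨c, hc⟩ := integral_prod_toSphere d
  have hprob := isProbabilityMeasure_uniformMeasure (d + 1) d.succ_pos
  have h0 := hc 0
  have hk := hc k
  set a : ℝ := ((volume : Measure (EuclideanSpace ℂ (Fin (d + 1)))).toSphere Set.univ)⁻¹.toReal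
  have h1 : ∀ f : Sphere (d + 1) → ℝ, ∫ v, f v ∂(uniformMeasure (d + 1)) =
      a * ∫ v, f v ∂(volume : Measure (EuclideanSpace ℂ (Fin (d + 1)))).toSphere := by
    intro f
    rw [uniformMeasure, integral_smul_measure, smul_eq_mul]
  -- The monomial k = 0 integrates to 1 under the uniform measure, which fixes the unknown constant.
  have h2 := h1 fun _ => 1
  simp only [Pi.zero_apply, mul_zero, pow_zero, Finset.prod_const_one, Nat.factorial_zero,
    Nat.cast_one, mul_one, Finset.sum_const_zero, add_zero] at h0
  rw [h0, integral_const, probReal_univ, one_smul] at h2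
  rw [h1, hk]
  have hd : (d.factorial : ℝ) ≠ 0 := by positivity
  have hac : a * c = d.factorial := by
    field_simp at h2
    linarith
  rw [mul_div_assoc', ← mul_assoc, hac, mul_comm (d.factorial : ℝ)]

/-! ### Quadratic forms and rank-one projectors -/

/-- The real part of the quadratic form `⟨x|X|x⟩`. -/
def quad {d : ℕ} (X : Matrix (Fin d) (Fin d) ℂ) (x : EuclideanSpace ℂ (Fin d)) : ℝ :=
  (star x.ofLp ⬝ᵥ X.mulVec x.ofLp).re

theorem measurement_eq {d : ℕ} (X : Matrix (Fin d) (Fin d) ℂ) (v : Sphere d) :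
    measurement X v = d * quad X v := rfl

theorem quad_eq_re_inner {d : ℕ} (X : Matrix (Fin d) (Fin d) ℂ) (x : EuclideanSpace ℂ (Fin d)) :
    quad X x = (inner ℂ x (Matrix.toEuclideanLin X x)).re := by
  rw [quad, EuclideanSpace.inner_eq_star_dotProduct, dotProduct_comm, Matrix.toLpLin_apply]

theorem quad_add {d : ℕ} (X Y : Matrix (Fin d) (Fin d) ℂ) (x : EuclideanSpace ℂ (Fin d)) :
    quad (X + Y) x = quad X x + quad Y x := by
  simp [quad, Matrix.add_mulVec, dotProduct_add]

theorem quad_sub {d : ℕ} (X Y : Matrix (Fin d) (Fin d) ℂ) (x : EuclideanSpace ℂ (Fin d)) :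
    quad (X - Y) x = quad X x - quad Y x := by
  simp [quad, Matrix.sub_mulVec, dotProduct_sub]

theorem quad_smul {d : ℕ} (r : ℝ) (X : Matrix (Fin d) (Fin d) ℂ) (x : EuclideanSpace ℂ (Fin d)) :
    quad (r • X) x = r * quad X x := by
  simp [quad, Matrix.smul_mulVec, dotProduct_smul]

theorem quad_one {d : ℕ} (x : EuclideanSpace ℂ (Fin d)) : quad 1 x = ‖x‖ ^ 2 := by
  rw [quad_eq_re_inner]
  simp [← Complex.ofReal_pow]

/-- The rank-one projector `|z⟩⟨z|`. -/
def rankOne {d : ℕ} (z : EuclideanSpace ℂ (Fin d)) : Matrix (Fin d) (Fin d) ℂ :=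
  Matrix.vecMulVec z.ofLp (star z.ofLp)

theorem rankOne_mulVec {d : ℕ} (z x : EuclideanSpace ℂ (Fin d)) :
    (rankOne z).mulVec x.ofLp = (inner ℂ z x) • z.ofLp := by
  rw [rankOne, Matrix.vecMulVec_mulVec, EuclideanSpace.inner_eq_star_dotProduct, dotProduct_comm]
  simp

theorem quad_rankOne {d : ℕ} (z x : EuclideanSpace ℂ (Fin d)) :
    quad (rankOne z) x = ‖inner ℂ z x‖ ^ 2 := by
  rw [quad, rankOne_mulVec, dotProduct_smul, dotProduct_comm,
    ← EuclideanSpace.inner_eq_star_dotProduct, smul_eq_mul, ← inner_conj_symm x z, Complex.mul_conj,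
    Complex.normSq_eq_norm_sq, Complex.ofReal_re]

theorem posSemidef_rankOne {d : ℕ} (z : EuclideanSpace ℂ (Fin d)) : (rankOne z).PosSemidef :=
  Matrix.posSemidef_vecMulVec_self_star _

theorem trace_rankOne {d : ℕ} (z : EuclideanSpace ℂ (Fin d)) :
    (rankOne z).trace = (‖z‖ ^ 2 : ℝ) := by
  rw [rankOne, Matrix.trace_vecMulVec, ← EuclideanSpace.inner_eq_star_dotProduct,
    inner_self_eq_norm_sq_to_K]
  simp

theorem sum_quad_basis {d : ℕ} (X : Matrix (Fin d) (Fin d) ℂ) {ι : Type*} [Fintype ι]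
    (b : OrthonormalBasis ι ℂ (EuclideanSpace ℂ (Fin d))) :
    ∑ i, quad X (b i) = X.trace.re := by
  simp_rw [quad_eq_re_inner]
  rw [← Complex.re_sum, ← LinearMap.trace_eq_sum_inner,
    LinearMap.trace_eq_sum_inner _ (EuclideanSpace.basisFun (Fin d) ℂ)]
  simp [Matrix.trace, EuclideanSpace.inner_single_left]

theorem continuous_quad {d : ℕ} (X : Matrix (Fin d) (Fin d) ℂ) : Continuous (quad X) := by
  have : quad X = fun x => (inner ℂ x (Matrix.toEuclideanLin X x)).re :=
    funext (quad_eq_re_inner X)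
  rw [this]
  have h := (Matrix.toEuclideanLin X).continuous_of_finiteDimensional
  fun_prop

/-- Expansion of the quadratic form in an orthonormal basis. -/
theorem quad_eq_sum_repr {d : ℕ} (X : Matrix (Fin d) (Fin d) ℂ) {ι : Type*} [Fintype ι]
    (b : OrthonormalBasis ι ℂ (EuclideanSpace ℂ (Fin d))) (x : EuclideanSpace ℂ (Fin d)) :
    quad X x = ∑ i, ∑ j, (star (b.repr x i) * b.repr x j *
      inner ℂ (b i) (Matrix.toEuclideanLin X (b j))).re := by
  rw [quad_eq_re_inner]
  conv_lhs => rw [← b.sum_repr x]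
  simp only [map_sum, map_smul, sum_inner, inner_sum, inner_smul_left, inner_smul_right,
    Complex.re_sum, Finset.mul_sum]
  rw [Finset.sum_comm]
  refine Finset.sum_congr rfl fun i _ => Finset.sum_congr rfl fun j _ => ?_
  rw [← mul_assoc, mul_comm (b.repr x j), Complex.star_def]

theorem exists_orthonormalBasis_zero {d : ℕ} {z : EuclideanSpace ℂ (Fin (d + 1))} (hz : ‖z‖ = 1) :
    ∃ b : OrthonormalBasis (Fin (d + 1)) ℂ (EuclideanSpace ℂ (Fin (d + 1))), b 0 = z := by
  have h : Orthonormal ℂ (Set.domRestrict {(0 : Fin (d + 1))} fun _ => z) := by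
    refine ⟨fun i => hz, fun i j hij => absurd (Subsingleton.elim i j) hij⟩
  obtain ⟨b, hb⟩ := h.exists_orthonormalBasis_extension_of_card_eq (by simp)
  exact ⟨b, hb 0 rfl⟩

/-! ### Unitary invariance and weighted moments -/

theorem integrable_of_continuous {d : ℕ} {μ : Measure (Sphere d)} [IsFiniteMeasure μ]
    {f : Sphere d → ℝ} (hf : Continuous f) : Integrable f μ :=
  hf.integrable_of_hasCompactSupport (HasCompactSupport.of_compactSpace f)

/-- Unitary invariance for integrals. -/
theorem integral_comp_unitary {d : ℕ}
    (U : EuclideanSpace ℂ (Fin d) ≃ₗᵢ[ℂ] EuclideanSpace ℂ (Fin d))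
    {f : EuclideanSpace ℂ (Fin d) → ℝ} (hf : Continuous f) :
    ∫ v : Sphere d, f (U v) ∂(uniformMeasure d) = ∫ v : Sphere d, f v ∂(uniformMeasure d) := by
  have hm : Continuous (unitaryAct U) :=
    (U.continuous.comp continuous_subtype_val).subtype_mk _
  conv_rhs => rw [← map_unitaryAct_uniformMeasure U]
  exact (integral_map (f := fun v : Sphere d => f v) hm.aemeasurable
    (hf.comp continuous_subtype_val).measurable.aestronglyMeasurable).symm

/-- The unitary that flips the sign of one coordinate. -/
def flipCoord {d : ℕ} (i : Fin d) : EuclideanSpace ℂ (Fin d) ≃ₗᵢ[ℂ] EuclideanSpace ℂ (Fin d) :=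
  LinearIsometryEquiv.piLpCongrRight 2 fun j =>
    if j = i then LinearIsometryEquiv.neg ℂ else LinearIsometryEquiv.refl ℂ ℂ

theorem flipCoord_apply {d : ℕ} (i : Fin d) (x : EuclideanSpace ℂ (Fin d)) (j : Fin d) :
    flipCoord i x j = if j = i then -x j else x j := by
  simp only [flipCoord, LinearIsometryEquiv.piLpCongrRight_apply]
  split_ifs <;> simp

/-- Flipping the sign of coordinate i keeps the measure and all moduli but negates the cross term,
so the integral is its own negative. -/
theorem integral_norm_pow_mul_offDiag {d : ℕ} (l i j : Fin d) (hij : i ≠ j) (k : ℕ) (c : ℂ) :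
    ∫ v : Sphere d, ‖v.1 l‖ ^ (2 * k) * (star (v.1 i) * v.1 j * c).re ∂(uniformMeasure d) = 0 := by
  have h := integral_comp_unitary (flipCoord i)
    (f := fun x => ‖x l‖ ^ (2 * k) * (star (x i) * x j * c).re) (by fun_prop)
  have h2 : ∀ v : Sphere d, ‖flipCoord i v.1 l‖ ^ (2 * k) *
      (star (flipCoord i v.1 i) * flipCoord i v.1 j * c).re =
      -(‖v.1 l‖ ^ (2 * k) * (star (v.1 i) * v.1 j * c).re) := by
    intro v
    have h3 : ‖flipCoord i v.1 l‖ = ‖v.1 l‖ := by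
      rw [flipCoord_apply]; split_ifs <;> simp
    rw [h3, flipCoord_apply, flipCoord_apply, if_pos rfl, if_neg hij.symm]
    simp
    ring
  simp_rw [h2, integral_neg] at h
  linarith

theorem integral_norm_pow_mul_norm_sq (d : ℕ) (j : Fin (d + 1)) (k : ℕ) :
    ∫ v : Sphere (d + 1), ‖v.1 0‖ ^ (2 * k) * ‖v.1 j‖ ^ 2 ∂(uniformMeasure (d + 1)) =
      (k.factorial * d.factorial / (d + k + 1).factorial : ℝ) * (1 + if j = 0 then (k : ℝ) else 0) := by
  have h := integral_prod_uniformMeasure d (Pi.single 0 k + Pi.single j 1)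
  have h1 : ∑ i, (Pi.single (0 : Fin (d + 1)) k + Pi.single j 1 : Fin (d + 1) → ℕ) i = k + 1 := by
    simp [Finset.sum_add_distrib]
  have h2 : ∀ v : Sphere (d + 1), ∏ i, ‖v.1 i‖ ^
      (2 * (Pi.single (0 : Fin (d + 1)) k + Pi.single j 1 : Fin (d + 1) → ℕ) i) =
      ‖v.1 0‖ ^ (2 * k) * ‖v.1 j‖ ^ 2 := by
    intro v
    simp_rw [Pi.add_apply, mul_add, pow_add, Finset.prod_mul_distrib]
    congr 1
    · rw [Finset.prod_eq_single 0] <;> simp +contextual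
    · rw [Finset.prod_eq_single j] <;> simp +contextual
  have h3 : (∏ i, (((Pi.single (0 : Fin (d + 1)) k + Pi.single j 1 : Fin (d + 1) → ℕ) i).factorial
      : ℝ)) = k.factorial * (1 + if j = 0 then (k : ℝ) else 0) := by
    rw [Finset.prod_eq_single 0]
    · by_cases hj : j = 0
      · subst hj
        simp [Nat.factorial_succ]
        ring
      · simp [hj, Ne.symm hj]
    · intro i _ hi
      by_cases hj : i = j <;> simp [hj, hi, Pi.single_apply]
      simp [hj ▸ hi]
    · simp
  simp_rw [h2] at h
  rw [h, h1, h3, ← add_assoc]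
  ring

/-- Moments of the overlap with a unit vector, weighted by a quadratic form. -/
theorem integral_inner_pow_mul_quad {d : ℕ} (X : Matrix (Fin (d + 1)) (Fin (d + 1)) ℂ)
    {z : EuclideanSpace ℂ (Fin (d + 1))} (hz : ‖z‖ = 1) (k : ℕ) :
    ∫ v : Sphere (d + 1), ‖inner ℂ z v.1‖ ^ (2 * k) * quad X v ∂(uniformMeasure (d + 1)) =
      (k.factorial * d.factorial / (d + k + 1).factorial : ℝ) * (X.trace.re + k * quad X z) := by
  obtain ⟨b, rfl⟩ := exists_orthonormalBasis_zero hz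
  have hprob := isProbabilityMeasure_uniformMeasure (d + 1) d.succ_pos
  -- A unitary carries z to the first coordinate vector. Cross terms then vanish; the diagonal terms
  -- sum to the trace, with an extra k at index 0 because (k+1)! = k!(1+k).
  have h := integral_comp_unitary b.repr (f := fun x => ‖x 0‖ ^ (2 * k) * ∑ i, ∑ j,
    (star (x i) * x j * inner ℂ (b i) (Matrix.toEuclideanLin X (b j))).re) (by fun_prop)
  simp_rw [← quad_eq_sum_repr, OrthonormalBasis.repr_apply_apply] at h
  rw [h]
  simp_rw [Finset.mul_sum]
  rw [integral_finsetSum _ fun i _ => integrable_of_continuous (by fun_prop)]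
  have h1 : ∀ i, ∫ v : Sphere (d + 1), ∑ j, ‖v.1 0‖ ^ (2 * k) *
      (star (v.1 i) * v.1 j * inner ℂ (b i) (Matrix.toEuclideanLin X (b j))).re
        ∂(uniformMeasure (d + 1)) =
      (k.factorial * d.factorial / (d + k + 1).factorial : ℝ) *
        (quad X (b i) + if i = 0 then k * quad X (b i) else 0) := by
    intro i
    rw [integral_finsetSum _ fun j _ => integrable_of_continuous (by fun_prop),
      Finset.sum_eq_single i (fun j _ hj => integral_norm_pow_mul_offDiag _ _ _ hj.symm _ _)
        (by simp)]
    have h2 : ∀ v : Sphere (d + 1), ‖v.1 0‖ ^ (2 * k) *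
        (star (v.1 i) * v.1 i * inner ℂ (b i) (Matrix.toEuclideanLin X (b i))).re =
        ‖v.1 0‖ ^ (2 * k) * ‖v.1 i‖ ^ 2 * quad X (b i) := by
      intro v
      rw [quad_eq_re_inner, Complex.star_def, mul_comm ((starRingEnd ℂ) _), Complex.mul_conj,
        Complex.normSq_eq_norm_sq, Complex.re_ofReal_mul, mul_assoc]
    simp_rw [h2]
    rw [integral_mul_const, integral_norm_pow_mul_norm_sq]
    split_ifs <;> ring
  simp_rw [h1]
  rw [← Finset.mul_sum, Finset.sum_add_distrib, sum_quad_basis]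
  simp

/-! ### Moments and exponential moments under Born's rule -/

theorem quad_nonneg {d : ℕ} {X : Matrix (Fin d) (Fin d) ℂ} (hX : X.PosSemidef)
    (x : EuclideanSpace ℂ (Fin d)) : 0 ≤ quad X x :=
  (Complex.le_def.1 (hX.dotProduct_mulVec_nonneg x.ofLp)).1

theorem IsState.trace_re {d : ℕ} {ρ : Matrix (Fin d) (Fin d) ℂ} (hρ : IsState ρ) :
    ρ.trace.re = 1 := by
  rw [hρ.2, Complex.one_re]

theorem IsState.quad_le_one {d : ℕ} {ρ : Matrix (Fin (d + 1)) (Fin (d + 1)) ℂ} (hρ : IsState ρ)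
    {z : EuclideanSpace ℂ (Fin (d + 1))} (hz : ‖z‖ = 1) : quad ρ z ≤ 1 := by
  obtain ⟨b, rfl⟩ := exists_orthonormalBasis_zero hz
  rw [← hρ.trace_re, ← sum_quad_basis ρ b]
  exact Finset.single_le_sum (f := fun i => quad ρ (b i)) (fun i _ => quad_nonneg hρ.1 _)
    (Finset.mem_univ 0)

theorem integral_bornMeasure {d : ℕ} {ρ : Matrix (Fin d) (Fin d) ℂ} (hρ : ρ.PosSemidef)
    (f : Sphere d → ℝ) :
    ∫ v, f v ∂(bornMeasure ρ) = ∫ v, f v * (d * quad ρ v) ∂(uniformMeasure d) := by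
  have hc : Continuous (measurement ρ) :=
    continuous_const.mul ((continuous_quad ρ).comp continuous_subtype_val)
  rw [bornMeasure, integral_withDensity_eq_integral_toReal_smul
    (by exact hc.measurable.ennreal_ofReal) (by simp)]
  refine integral_congr_ae (.of_forall fun v => ?_)
  simp only [smul_eq_mul, measurement_eq]
  rw [ENNReal.toReal_ofReal (mul_nonneg (Nat.cast_nonneg _) (quad_nonneg hρ _)), mul_comm]

/-- The overlap of the outcome with a fixed vector, scaled by `d + 1`. -/
def scaledOverlap {d : ℕ} (z : EuclideanSpace ℂ (Fin d)) (v : Sphere d) : ℝ :=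
  (d + 1) * ‖inner ℂ z v.1‖ ^ 2

theorem scaledOverlap_nonneg {d : ℕ} (z : EuclideanSpace ℂ (Fin d)) (v : Sphere d) :
    0 ≤ scaledOverlap z v := by
  unfold scaledOverlap; positivity

theorem continuous_scaledOverlap {d : ℕ} (z : EuclideanSpace ℂ (Fin d)) :
    Continuous (scaledOverlap z) := by
  unfold scaledOverlap; fun_prop

theorem integral_scaledOverlap_pow {d : ℕ} {ρ : Matrix (Fin (d + 1)) (Fin (d + 1)) ℂ}
    (hρ : IsState ρ) {z : EuclideanSpace ℂ (Fin (d + 1))} (hz : ‖z‖ = 1) (k : ℕ) :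
    ∫ v, scaledOverlap z v ^ k ∂(bornMeasure ρ) =
      ((d + 1).factorial * (d + 1 + 1) ^ k / (d + 1 + k).factorial : ℝ) *
        (k.factorial * (1 + k * quad ρ z)) := by
  rw [integral_bornMeasure hρ.1]
  have h : ∀ v : Sphere (d + 1), scaledOverlap z v ^ k * (((d + 1 : ℕ) : ℝ) * quad ρ v) =
      (((d + 1 : ℕ) : ℝ) * (d + 1 + 1) ^ k) * (‖inner ℂ z v.1‖ ^ (2 * k) * quad ρ v) := by
    intro v
    rw [scaledOverlap, mul_pow, ← pow_mul]
    push_cast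
    ring
  simp_rw [h]
  rw [integral_const_mul, integral_inner_pow_mul_quad ρ hz, hρ.trace_re, Nat.factorial_succ d,
    show d + k + 1 = d + 1 + k by ring]
  push_cast
  ring

theorem integral_scaledOverlap {d : ℕ} {ρ : Matrix (Fin (d + 1)) (Fin (d + 1)) ℂ}
    (hρ : IsState ρ) {z : EuclideanSpace ℂ (Fin (d + 1))} (hz : ‖z‖ = 1) :
    ∫ v, scaledOverlap z v ∂(bornMeasure ρ) = 1 + quad ρ z := by
  have h := integral_scaledOverlap_pow hρ hz 1
  simp only [pow_one, Nat.factorial_one, Nat.cast_one, one_mul] at h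
  rw [h, Nat.factorial_succ (d + 1)]
  have : ((d + 1).factorial : ℝ) ≠ 0 := by positivity
  push_cast
  field_simp

/-- With N = d + 1 the dimensional prefactor is N!(N+1)^k/(N+k)!, which never exceeds 1. This is
what frees the tail bounds of the dimension. -/
theorem integral_scaledOverlap_pow_le {d : ℕ} {ρ : Matrix (Fin (d + 1)) (Fin (d + 1)) ℂ}
    (hρ : IsState ρ) {z : EuclideanSpace ℂ (Fin (d + 1))} (hz : ‖z‖ = 1) (k : ℕ) :
    ∫ v, scaledOverlap z v ^ k ∂(bornMeasure ρ) ≤ k.factorial * (1 + k * quad ρ z) := by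
  rw [integral_scaledOverlap_pow hρ hz]
  have hq := quad_nonneg hρ.1 z
  refine mul_le_of_le_one_left (by positivity) ?_
  rw [div_le_one (by positivity)]
  exact_mod_cast Nat.factorial_mul_pow_le_factorial

theorem isProbabilityMeasure_bornMeasure {d : ℕ} {ρ : Matrix (Fin (d + 1)) (Fin (d + 1)) ℂ}
    (hρ : IsState ρ) : IsProbabilityMeasure (bornMeasure ρ) := by
  have hz : ‖(EuclideanSpace.single 0 1 : EuclideanSpace ℂ (Fin (d + 1)))‖ = 1 := by simp
  have h := integral_scaledOverlap_pow hρ hz 0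
  have : ((d + 1).factorial : ℝ) ≠ 0 := by positivity
  simp only [pow_zero, integral_const, smul_eq_mul, mul_one, add_zero, Nat.factorial_zero,
    Nat.cast_one, Nat.cast_zero, zero_mul, div_self this] at h
  constructor
  rw [Measure.real, ENNReal.toReal_eq_one_iff] at h
  exact h

/-- The k! in the moment bound cancels the one in the exponential series, leaving ∑ θ^k and ∑ k θ^k.
-/
theorem integral_exp_mul_scaledOverlap_le {d : ℕ} {ρ : Matrix (Fin (d + 1)) (Fin (d + 1)) ℂ}
    (hρ : IsState ρ) {z : EuclideanSpace ℂ (Fin (d + 1))} (hz : ‖z‖ = 1) {θ : ℝ} (h0 : 0 ≤ θ)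
    (h1 : θ < 1) :
    ∫ v, Real.exp (θ * scaledOverlap z v) ∂(bornMeasure ρ) ≤
      (1 - θ)⁻¹ + quad ρ z * (θ / (1 - θ) ^ 2) := by
  have hprob := isProbabilityMeasure_bornMeasure hρ
  have hS := continuous_scaledOverlap z
  set F : ℕ → Sphere (d + 1) → ℝ := fun k v => (θ * scaledOverlap z v) ^ k / k.factorial
  have hF0 : ∀ k v, 0 ≤ F k v := fun k v =>
    div_nonneg (pow_nonneg (mul_nonneg h0 (scaledOverlap_nonneg z v)) k) (by positivity)
  have hFle : ∀ k, ∫ v, F k v ∂(bornMeasure ρ) ≤ θ ^ k + quad ρ z * (k * θ ^ k) := by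
    intro k
    have h : ∀ v, F k v = θ ^ k / k.factorial * scaledOverlap z v ^ k := by
      intro v; simp only [F, mul_pow]; ring
    simp_rw [h]
    rw [integral_const_mul]
    calc _ ≤ θ ^ k / k.factorial * (k.factorial * (1 + k * quad ρ z)) := by
          gcongr; exact integral_scaledOverlap_pow_le hρ hz k
      _ = _ := by
          have : (k.factorial : ℝ) ≠ 0 := by positivity
          field_simp
  have hs : HasSum (fun k : ℕ => θ ^ k + quad ρ z * (k * θ ^ k))
      ((1 - θ)⁻¹ + quad ρ z * (θ / (1 - θ) ^ 2)) := by
    refine (hasSum_geometric_of_lt_one h0 h1).add (HasSum.mul_left _ ?_)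
    exact hasSum_coe_mul_geometric_of_norm_lt_one (by rwa [Real.norm_of_nonneg h0])
  have hsum : HasSum (fun k => ∫ v, F k v ∂(bornMeasure ρ))
      (∫ v, ∑' k, F k v ∂(bornMeasure ρ)) := by
    refine hasSum_integral_of_summable_integral_norm
      (fun k => integrable_of_continuous (by fun_prop)) ?_
    refine Summable.of_nonneg_of_le (fun k => by positivity) (fun k => ?_) hs.summable
    simp_rw [Real.norm_of_nonneg (hF0 k _)]
    exact hFle k
  have hexp : ∀ v, ∑' k, F k v = Real.exp (θ * scaledOverlap z v) := by
    intro v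
    rw [Real.exp_eq_exp_ℝ, NormedSpace.exp_eq_tsum_div]
  simp_rw [hexp] at hsum
  exact hasSum_le hFle hsum hs

theorem integral_exp_neg_mul_scaledOverlap_le {d : ℕ}
    {ρ : Matrix (Fin (d + 1)) (Fin (d + 1)) ℂ} (hρ : IsState ρ)
    {z : EuclideanSpace ℂ (Fin (d + 1))} (hz : ‖z‖ = 1) {θ : ℝ} (h0 : 0 ≤ θ) :
    ∫ v, Real.exp (-(θ * scaledOverlap z v)) ∂(bornMeasure ρ) ≤
      1 - θ * (1 + quad ρ z) + θ ^ 2 * (1 + 2 * quad ρ z) := by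
  have hprob := isProbabilityMeasure_bornMeasure hρ
  have hS := continuous_scaledOverlap z
  have hle : ∀ v, Real.exp (-(θ * scaledOverlap z v)) ≤
      1 - θ * scaledOverlap z v + θ ^ 2 / 2 * scaledOverlap z v ^ 2 := by
    intro v
    set x := θ * scaledOverlap z v with hx
    have hx0 : 0 ≤ x := mul_nonneg h0 (scaledOverlap_nonneg z v)
    have h2 : θ ^ 2 / 2 * scaledOverlap z v ^ 2 = x ^ 2 / 2 := by rw [hx]; ring
    rw [h2, Real.exp_neg, inv_le_iff_one_le_mul₀ (Real.exp_pos x)]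
    have hq := Real.quadratic_le_exp_of_nonneg hx0
    have hpos : 0 ≤ 1 - x + x ^ 2 / 2 := by nlinarith [sq_nonneg (x - 1)]
    -- The product equals 1 + x⁴/4.
    calc (1 : ℝ) ≤ (1 - x + x ^ 2 / 2) * (1 + x + x ^ 2 / 2) := by nlinarith [sq_nonneg (x ^ 2)]
      _ ≤ _ := by gcongr
  calc _ ≤ ∫ v, (1 - θ * scaledOverlap z v + θ ^ 2 / 2 * scaledOverlap z v ^ 2)
        ∂(bornMeasure ρ) :=
        integral_mono (integrable_of_continuous (by fun_prop))
          (integrable_of_continuous (by fun_prop)) hle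
    _ = 1 - θ * (1 + quad ρ z) +
        θ ^ 2 / 2 * ∫ v, scaledOverlap z v ^ 2 ∂(bornMeasure ρ) := by
      rw [integral_add (integrable_of_continuous (by fun_prop))
        (integrable_of_continuous (by fun_prop)),
        integral_sub (integrable_of_continuous (by fun_prop))
        (integrable_of_continuous (by fun_prop)), integral_const_mul, integral_const_mul,
        integral_scaledOverlap hρ hz]
      simp
    _ ≤ 1 - θ * (1 + quad ρ z) +
        θ ^ 2 / 2 * ((2 : ℕ).factorial * (1 + (2 : ℕ) * quad ρ z)) := by
      gcongr
      exact integral_scaledOverlap_pow_le hρ hz 2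
    _ = _ := by
      simp
      ring

theorem one_sub_mul_exp_ge {θ : ℝ} (h0 : 0 ≤ θ) (h1 : θ ≤ 1 / 8) :
    1 ≤ (1 - θ) * Real.exp (θ + θ ^ 2) := by
  have hq := Real.quadratic_le_exp_of_nonneg (show 0 ≤ θ + θ ^ 2 by positivity)
  calc (1 : ℝ) ≤ (1 - θ) * (1 + (θ + θ ^ 2) + (θ + θ ^ 2) ^ 2 / 2) := by
        have h3 : 0 ≤ θ ^ 2 * (1 / 8 - θ) := by nlinarith [sq_nonneg θ]
        have h4 : 0 ≤ θ ^ 3 * (1 / 8 - θ) := mul_nonneg (by positivity) (by linarith)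
        have h5 : 0 ≤ θ ^ 4 * (1 / 8 - θ) := mul_nonneg (by positivity) (by linarith)
        nlinarith [sq_nonneg θ, pow_nonneg h0 3, pow_nonneg h0 4]
    _ ≤ _ := by
      gcongr
      linarith

theorem one_sub_le_exp_neg {y : ℝ} (h0 : 0 ≤ y) (h1 : y < 1) :
    1 - y ≤ Real.exp (-(y + y ^ 2 / 2)) := by
  have h := Real.hasSum_pow_div_log_of_abs_lt_one (by rwa [abs_of_nonneg h0] : |y| < 1)
  have h2 := sum_le_hasSum (Finset.range 2) (fun i _ => by positivity) h
  rw [← Real.log_le_iff_le_exp (by linarith)]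
  norm_num [Finset.sum_range_succ] at h2
  linarith

/-- The centred overlap of the outcome of one measurement is subgaussian for small parameters. -/
theorem integral_exp_centered_le {d : ℕ} {ρ : Matrix (Fin (d + 1)) (Fin (d + 1)) ℂ}
    (hρ : IsState ρ) {z : EuclideanSpace ℂ (Fin (d + 1))} (hz : ‖z‖ = 1) {θ : ℝ}
    (hθ : |θ| ≤ 1 / 8) :
    ∫ v, Real.exp (θ * (scaledOverlap z v - (1 + quad ρ z))) ∂(bornMeasure ρ) ≤
      Real.exp (2 * θ ^ 2) := by
  have hp0 := quad_nonneg hρ.1 z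
  have hp1 := hρ.quad_le_one hz
  have hsplit : ∀ v, Real.exp (θ * (scaledOverlap z v - (1 + quad ρ z))) =
      Real.exp (-(θ * (1 + quad ρ z))) * Real.exp (θ * scaledOverlap z v) := by
    intro v; rw [← Real.exp_add]; ring_nf
  simp_rw [hsplit]
  rw [integral_const_mul]
  set p := quad ρ z
  rcases le_total 0 θ with h0 | h0
  -- The bound factors as (1-θ)⁻²(1-θ(1-p)). After (1-θ)⁻¹ ≤ exp(θ+θ²), the linear terms 2θ, -θ(1-p)
  -- and -θ(1+p) cancel and 2θ² is left.
  · rw [abs_of_nonneg h0] at hθ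
    have h := integral_exp_mul_scaledOverlap_le hρ hz h0 (by linarith)
    have hpos : 0 < 1 - θ := by linarith
    have h1 : (1 - θ)⁻¹ + p * (θ / (1 - θ) ^ 2) ≤
        Real.exp (θ + θ ^ 2) ^ 2 * Real.exp (-(θ * (1 - p))) := by
      have h2 : (1 - θ)⁻¹ ≤ Real.exp (θ + θ ^ 2) := by
        rw [inv_le_iff_one_le_mul₀ hpos, mul_comm]
        exact one_sub_mul_exp_ge h0 hθ
      have h3 : 1 - θ * (1 - p) ≤ Real.exp (-(θ * (1 - p))) := by
        have := Real.add_one_le_exp (-(θ * (1 - p)))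
        linarith
      have h4 : 0 ≤ 1 - θ * (1 - p) := by nlinarith
      calc (1 - θ)⁻¹ + p * (θ / (1 - θ) ^ 2) = ((1 - θ)⁻¹) ^ 2 * (1 - θ * (1 - p)) := by
            field_simp; ring
        _ ≤ _ := by gcongr
    calc _ ≤ Real.exp (-(θ * (1 + p))) *
          (Real.exp (θ + θ ^ 2) ^ 2 * Real.exp (-(θ * (1 - p)))) := by
          gcongr; exact h.trans h1
      _ = _ := by
        rw [← Real.exp_nat_mul, ← Real.exp_add, ← Real.exp_add]
        congr 1
        push_cast
        ring
  · rw [abs_of_nonpos h0] at hθ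
    obtain ⟨t, rfl⟩ : ∃ t, θ = -t := ⟨-θ, by ring⟩
    rw [neg_neg] at hθ
    have h0 : 0 ≤ t := by linarith
    have h := integral_exp_neg_mul_scaledOverlap_le hρ hz h0
    simp_rw [neg_mul, neg_neg]
    -- The bound is now 1 - tw. Using only 1 - y ≤ exp(-y) would leave t²(1+2p), as large as 3t²;
    -- the extra y²/2 removes the excess because w² ≥ 2(2p-1).
    set w := 1 + p - t * (1 + 2 * p) with hw
    have hwl : 7 / 8 + 3 / 4 * p ≤ w := by nlinarith
    have hwu : w ≤ 2 := by nlinarith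
    have hy := one_sub_le_exp_neg (y := t * w) (by nlinarith) (by nlinarith)
    have hw2 : 2 * (2 * p - 1) ≤ w ^ 2 := by nlinarith
    calc _ ≤ Real.exp (t * (1 + p)) * Real.exp (-(t * w + (t * w) ^ 2 / 2)) := by
          gcongr
          refine h.trans (le_of_eq_of_le ?_ hy)
          rw [hw]; ring
      _ ≤ _ := by
        rw [← Real.exp_add]
        gcongr
        rw [hw] at hw2 ⊢
        nlinarith [mul_le_mul_of_nonneg_left hw2 (sq_nonneg t)]

/-! ### The least-squares estimator in closed form -/

theorem leastSquaresObjective_add_smul {d n : ℕ} [IsFiniteMeasure (uniformMeasure d)]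
    (v : Fin n → Sphere d) (X R : Matrix (Fin d) (Fin d) ℂ) (s : ℝ) :
    leastSquaresObjective v (X + s • R) = leastSquaresObjective v X +
      2 * s * ((∫ w, measurement X w * measurement R w ∂(uniformMeasure d)) -
        (1 / n : ℝ) * ∑ i, measurement R (v i)) +
      s ^ 2 * ∫ w, measurement R w ^ 2 ∂(uniformMeasure d) := by
  have hc : ∀ X : Matrix (Fin d) (Fin d) ℂ, Continuous (measurement X) := fun X =>
    continuous_const.mul ((continuous_quad X).comp continuous_subtype_val)
  have hX := hc X
  have hR := hc R
  have hm : ∀ w, measurement (X + s • R) w = measurement X w + s * measurement R w := by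
    intro w
    simp only [measurement_eq, quad_add, quad_smul]
    ring
  have hsq : ∀ w, (measurement X w + s * measurement R w) ^ 2 = measurement X w ^ 2 +
      2 * s * (measurement X w * measurement R w) + s ^ 2 * measurement R w ^ 2 := by
    intro w; ring
  simp only [leastSquaresObjective, hm, hsq, Finset.sum_add_distrib, ← Finset.mul_sum]
  rw [integral_add (integrable_of_continuous (by fun_prop))
    (integrable_of_continuous (by fun_prop)), integral_add (integrable_of_continuous (by fun_prop))
    (integrable_of_continuous (by fun_prop)), integral_const_mul, integral_const_mul]
  ring

theorem eq_zero_of_forall_quadratic_nonneg {a b : ℝ} (hb : 0 ≤ b)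
    (h : ∀ s : ℝ, 0 ≤ 2 * s * a + s ^ 2 * b) : a = 0 := by
  -- The minimizer would be -a/b; b + 1 also covers b = 0.
  have h1 := h (-(a / (b + 1)))
  have h2 : 2 * (-(a / (b + 1))) * a + (-(a / (b + 1))) ^ 2 * b =
      -(a ^ 2 * ((b + 2) / (b + 1) ^ 2)) := by
    field_simp
    ring
  rw [h2] at h1
  have h3 : 0 < (b + 2) / (b + 1) ^ 2 := by positivity
  have h4 : a ^ 2 ≤ 0 := by
    by_contra hcon
    push Not at hcon
    have := mul_pos hcon h3
    linarith
  exact pow_eq_zero_iff two_ne_zero |>.1 (le_antisymm h4 (sq_nonneg a))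

/-- This is the normal equation in the direction |z⟩⟨z|; its integral term is the weighted moment
with k = 1. -/
theorem IsLeastSquares.trace_add_quad {d n : ℕ} {v : Fin n → Sphere (d + 1)}
    {L : Matrix (Fin (d + 1)) (Fin (d + 1)) ℂ} (hL : IsLeastSquares v L)
    {z : EuclideanSpace ℂ (Fin (d + 1))} (hz : ‖z‖ = 1) :
    L.trace.re + quad L z = (1 / n : ℝ) * ∑ i, scaledOverlap z (v i) := by
  have hprob := isProbabilityMeasure_uniformMeasure (d + 1) d.succ_pos
  have h := eq_zero_of_forall_quadratic_nonneg
    (a := (∫ w, measurement L w * measurement (rankOne z) w ∂(uniformMeasure (d + 1))) -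
      (1 / n : ℝ) * ∑ i, measurement (rankOne z) (v i))
    (b := ∫ w, measurement (rankOne z) w ^ 2 ∂(uniformMeasure (d + 1)))
    (integral_nonneg fun w => sq_nonneg (measurement (rankOne z) w)) (fun s => by
      have hs := hL.2 (L + s • rankOne z)
        (hL.1.add ((posSemidef_rankOne z).isHermitian.smul (IsSelfAdjoint.all s)))
      rw [leastSquaresObjective_add_smul, add_assoc] at hs
      linarith)
  have h1 : ∀ w : Sphere (d + 1), measurement L w * measurement (rankOne z) w =
      ((d + 1 : ℕ) : ℝ) ^ 2 * (‖inner ℂ z w.1‖ ^ (2 * 1) * quad L w) := by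
    intro w
    rw [measurement_eq, measurement_eq, quad_rankOne]
    ring
  have h2 : ∀ i, measurement (rankOne z) (v i) =
      ((d + 1 : ℕ) : ℝ) / (d + 2) * scaledOverlap z (v i) := by
    intro i
    rw [measurement_eq, quad_rankOne, scaledOverlap]
    push_cast
    field_simp
    ring
  simp_rw [h1, h2] at h
  rw [integral_const_mul, integral_inner_pow_mul_quad L hz, ← Finset.mul_sum,
    show d + 1 + 1 = d + 2 by ring, Nat.factorial_succ (d + 1), Nat.factorial_succ d] at h
  have hd : (d.factorial : ℝ) ≠ 0 := by positivity
  have h3 : ((d + 1 : ℕ) : ℝ) / (d + 2) * (L.trace.re + quad L z -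
      (1 / n : ℝ) * ∑ i, scaledOverlap z (v i)) = 0 := by
    rw [← h]
    push_cast
    field_simp
    simp only [Nat.factorial_one, Nat.cast_one]
    ring
  rcases mul_eq_zero.1 h3 with h4 | h4
  · have : (0 : ℝ) < ((d + 1 : ℕ) : ℝ) / (d + 2) := by positivity
    exact absurd h4 this.ne'
  · linarith

theorem sum_scaledOverlap_basis {d : ℕ} (b : OrthonormalBasis (Fin d) ℂ (EuclideanSpace ℂ (Fin d)))
    (v : Sphere d) : ∑ j, scaledOverlap (b j) v = d + 1 := by
  have h := b.sum_sq_norm_inner_right v.1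
  have hv : ‖v.1‖ = 1 := by simp
  simp only [scaledOverlap, ← Finset.mul_sum, h, hv]
  ring

/-- Summing the normal equation over an orthonormal basis gives (d + 2) tr L on one side and d + 2
on the other. -/
theorem IsLeastSquares.trace_re {d n : ℕ} (hn : 0 < n) {v : Fin n → Sphere (d + 1)}
    {L : Matrix (Fin (d + 1)) (Fin (d + 1)) ℂ} (hL : IsLeastSquares v L) : L.trace.re = 1 := by
  let b := EuclideanSpace.basisFun (Fin (d + 1)) ℂ
  have h : ∑ j, (L.trace.re + quad L (b j)) =
      ∑ j, (1 / n : ℝ) * ∑ i, scaledOverlap (b j) (v i) :=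
    Finset.sum_congr rfl fun j _ => hL.trace_add_quad (b.orthonormal.1 j)
  rw [Finset.sum_add_distrib, sum_quad_basis, ← Finset.mul_sum, Finset.sum_comm] at h
  simp only [sum_scaledOverlap_basis, Finset.sum_const, Finset.card_univ, Fintype.card_fin,
    nsmul_eq_mul] at h
  have hn' : (n : ℝ) ≠ 0 := by positivity
  rw [← mul_assoc, one_div_mul_cancel hn', one_mul] at h
  push_cast at h
  have hd : (0 : ℝ) < d + 2 := by positivity
  nlinarith

theorem IsLeastSquares.quad_eq {d n : ℕ} (hn : 0 < n) {v : Fin n → Sphere (d + 1)}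
    {L : Matrix (Fin (d + 1)) (Fin (d + 1)) ℂ} (hL : IsLeastSquares v L)
    {z : EuclideanSpace ℂ (Fin (d + 1))} (hz : ‖z‖ = 1) :
    quad L z = (1 / n : ℝ) * ∑ i, scaledOverlap z (v i) - 1 := by
  have := hL.trace_add_quad hz
  rw [hL.trace_re hn] at this
  linarith

/-! ### Spectral facts in terms of quadratic forms -/

theorem quad_eigenvectorBasis {d : ℕ} {A : Matrix (Fin d) (Fin d) ℂ} (hA : A.IsHermitian)
    (i : Fin d) : quad A (hA.eigenvectorBasis i) = hA.eigenvalues i :=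
  (hA.eigenvalues_eq i).symm

theorem quad_eq_sum_eigenvalues {d : ℕ} {A : Matrix (Fin d) (Fin d) ℂ} (hA : A.IsHermitian)
    (x : EuclideanSpace ℂ (Fin d)) :
    quad A x = ∑ i, hA.eigenvalues i * ‖inner ℂ (hA.eigenvectorBasis i) x‖ ^ 2 := by
  rw [quad_eq_sum_repr A hA.eigenvectorBasis]
  refine Finset.sum_congr rfl fun i _ => ?_
  have h : ∀ j, Matrix.toEuclideanLin A (hA.eigenvectorBasis j) =
      (hA.eigenvalues j : ℂ) • hA.eigenvectorBasis j := by
    intro j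
    rw [Matrix.toLpLin_apply, hA.mulVec_eigenvectorBasis]
    rfl
  rw [Finset.sum_eq_single i]
  · rw [h, inner_smul_right, orthonormal_iff_ite.1 hA.eigenvectorBasis.orthonormal, if_pos rfl,
      mul_one, OrthonormalBasis.repr_apply_apply, Complex.star_def,
      mul_comm ((starRingEnd ℂ) _), Complex.mul_conj, Complex.normSq_eq_norm_sq, mul_comm,
      ← Complex.ofReal_mul, Complex.ofReal_re]
  · intro j _ hj
    rw [h, inner_smul_right, orthonormal_iff_ite.1 hA.eigenvectorBasis.orthonormal,
      if_neg (Ne.symm hj)]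
    simp
  · simp

theorem quad_mul_eigenvector {d : ℕ} {A : Matrix (Fin d) (Fin d) ℂ} (hA : A.IsHermitian)
    (X : Matrix (Fin d) (Fin d) ℂ) (i : Fin d) :
    quad (X * A) (hA.eigenvectorBasis i) = hA.eigenvalues i * quad X (hA.eigenvectorBasis i) := by
  rw [quad, ← Matrix.mulVec_mulVec, hA.mulVec_eigenvectorBasis, Matrix.mulVec_smul,
    dotProduct_smul, Complex.real_smul, Complex.re_ofReal_mul, quad]

theorem posSemidef_of_quad_nonneg {d : ℕ} {A : Matrix (Fin d) (Fin d) ℂ} (hA : A.IsHermitian)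
    (h : ∀ x, 0 ≤ quad A x) : A.PosSemidef := by
  refine Matrix.PosSemidef.of_dotProduct_mulVec_nonneg hA fun x => ?_
  rw [Complex.le_def]
  exact ⟨h (WithLp.toLp 2 x), (hA.im_star_dotProduct_mulVec_self x).symm⟩

/-- A quadratic form is controlled by its values on unit vectors. -/
theorem quad_le_of_unit {d : ℕ} {A : Matrix (Fin d) (Fin d) ℂ} {c : ℝ}
    (h : ∀ z, ‖z‖ = 1 → quad A z ≤ c) (x : EuclideanSpace ℂ (Fin d)) :
    quad A x ≤ c * ‖x‖ ^ 2 := by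
  rcases eq_or_ne x 0 with rfl | hx
  · simp [quad]
  · have hx' : 0 < ‖x‖ := norm_pos_iff.2 hx
    have h1 := h ((‖x‖⁻¹ : ℂ) • x) (by simp [norm_smul, hx])
    have h2 : quad A ((‖x‖⁻¹ : ℂ) • x) = ‖x‖⁻¹ ^ 2 * quad A x := by
      simp only [quad_eq_re_inner, map_smul, inner_smul_left, inner_smul_right]
      rw [← Complex.ofReal_inv, Complex.conj_ofReal, Complex.re_ofReal_mul, Complex.re_ofReal_mul]
      ring
    rw [h2, inv_pow, inv_mul_le_iff₀ (by positivity)] at h1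
    linarith

/-! ### Projection onto the set of states -/

/-- The real inner product of matrices that induces the Frobenius norm. -/
def frobeniusInner {d : ℕ} (A B : Matrix (Fin d) (Fin d) ℂ) : ℝ := (A.conjTranspose * B).trace.re

theorem frobeniusNorm_sq {d : ℕ} (A : Matrix (Fin d) (Fin d) ℂ) :
    frobeniusNorm A ^ 2 = frobeniusInner A A := by
  have h0 : 0 ≤ ∑ i, ∑ j, ‖A i j‖ ^ 2 := by positivity
  rw [frobeniusNorm, Matrix.frobenius_norm_def, frobeniusInner]
  simp only [Real.rpow_two]
  rw [← Real.sqrt_eq_rpow, Real.sq_sqrt h0, Matrix.trace, Complex.re_sum, Finset.sum_comm]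
  refine Finset.sum_congr rfl fun i _ => ?_
  rw [Matrix.diag_apply, Matrix.mul_apply, Complex.re_sum]
  refine Finset.sum_congr rfl fun j _ => ?_
  rw [Matrix.conjTranspose_apply, Complex.star_def, mul_comm, Complex.mul_conj,
    Complex.normSq_eq_norm_sq, Complex.ofReal_re]

theorem frobeniusNorm_nonneg {d : ℕ} (A : Matrix (Fin d) (Fin d) ℂ) : 0 ≤ frobeniusNorm A := by
  rw [frobeniusNorm, Matrix.frobenius_norm_def]
  positivity

theorem frobeniusInner_comm {d : ℕ} (A B : Matrix (Fin d) (Fin d) ℂ) :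
    frobeniusInner A B = frobeniusInner B A := by
  have h : B.conjTranspose * A = (A.conjTranspose * B).conjTranspose := by simp
  rw [frobeniusInner, frobeniusInner, h, Matrix.trace_conjTranspose, Complex.star_def,
    Complex.conj_re]

theorem frobeniusInner_sub_smul {d : ℕ} (M D : Matrix (Fin d) (Fin d) ℂ) (s : ℝ) :
    frobeniusInner (M - s • D) (M - s • D) =
      frobeniusInner M M - 2 * s * frobeniusInner M D + s ^ 2 * frobeniusInner D D := by
  have h := frobeniusInner_comm D M
  simp only [frobeniusInner, Matrix.conjTranspose_sub, Matrix.conjTranspose_smul, sub_mul, mul_sub,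
    Matrix.smul_mul, Matrix.mul_smul, Matrix.trace_sub, Matrix.trace_smul, Complex.sub_re,
    Complex.real_smul, Complex.re_ofReal_mul, star_trivial] at h ⊢
  rw [h]
  ring

theorem IsState.convex_comb {d : ℕ} {σ τ : Matrix (Fin d) (Fin d) ℂ} (hσ : IsState σ)
    (hτ : IsState τ) {s : ℝ} (h0 : 0 ≤ s) (h1 : s ≤ 1) : IsState (σ + s • (τ - σ)) := by
  have h : σ + s • (τ - σ) = (1 - s) • σ + s • τ := by
    rw [smul_sub, sub_smul, one_smul]; abel
  rw [h]
  refine ⟨(hσ.1.smul (sub_nonneg.2 h1)).add (hτ.1.smul h0), ?_⟩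
  rw [Matrix.trace_add, Matrix.trace_smul, Matrix.trace_smul, hσ.2, hτ.2, ← add_smul]
  simp

/-- The variational inequality of the projection onto the set of states. -/
theorem IsStateProjection.frobeniusInner_le {d : ℕ} {L σ τ : Matrix (Fin d) (Fin d) ℂ}
    (h : IsStateProjection L σ) (hτ : IsState τ) :
    frobeniusInner (L - σ) (τ - σ) ≤ 0 := by
  by_contra hcon
  push Not at hcon
  set a := frobeniusInner (L - σ) (τ - σ)
  set b := frobeniusInner (τ - σ) (τ - σ)
  have hb : 0 ≤ b := (sq_nonneg _).trans_eq (frobeniusNorm_sq _)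
  have key : ∀ s : ℝ, 0 ≤ s → s ≤ 1 → 0 ≤ -(2 * s * a) + s ^ 2 * b := by
    intro s h0 h1
    have h2 := pow_le_pow_left₀ (frobeniusNorm_nonneg _) (h.2 _ (h.1.convex_comb hτ h0 h1)) 2
    rw [frobeniusNorm_sq, frobeniusNorm_sq, ← sub_sub, frobeniusInner_sub_smul] at h2
    linarith
  -- This step length stays in [0, 1] and is short enough for the linear decrease to dominate.
  have h1 := key (a / (a + b)) (by positivity) ((div_le_one (by positivity)).2 (by linarith))
  have h2 : -(2 * (a / (a + b)) * a) + (a / (a + b)) ^ 2 * b =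
      -(a ^ 2 * ((2 * a + b) / (a + b) ^ 2)) := by
    field_simp
    ring
  rw [h2] at h1
  have h3 : 0 < a ^ 2 * ((2 * a + b) / (a + b) ^ 2) := by positivity
  linarith

theorem frobeniusInner_rankOne {d : ℕ} {M : Matrix (Fin d) (Fin d) ℂ} (hM : M.IsHermitian)
    (z : EuclideanSpace ℂ (Fin d)) : frobeniusInner M (rankOne z) = quad M z := by
  rw [frobeniusInner, hM.eq, rankOne, Matrix.mul_vecMulVec, Matrix.trace_vecMulVec,
    dotProduct_comm, quad]

theorem isState_rankOne {d : ℕ} {z : EuclideanSpace ℂ (Fin d)} (hz : ‖z‖ = 1) :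
    IsState (rankOne z) :=
  ⟨posSemidef_rankOne z, by rw [trace_rankOne, hz]; simp⟩

/-- Projecting onto the states at most doubles the distance to a state in operator norm. -/
theorem IsStateProjection.abs_quad_sub_le {d : ℕ} {L σ ρ : Matrix (Fin d) (Fin d) ℂ} {τ : ℝ}
    (h : IsStateProjection L σ) (hL : L.IsHermitian) (htr : L.trace.re = 1) (hρ : IsState ρ)
    (hτ : ∀ z, ‖z‖ = 1 → |quad (L - ρ) z| ≤ τ) {z : EuclideanSpace ℂ (Fin d)} (hz : ‖z‖ = 1) :
    |quad (σ - ρ) z| ≤ 2 * τ := by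
  have hσ := h.1.1.isHermitian
  have hM : (L - σ).IsHermitian := hL.sub hσ
  set x₀ := frobeniusInner (L - σ) σ with hx₀
  -- Y is the dual slack, so that L = σ + x₀ - Y. Testing the variational inequality on rank-one
  -- states gives L - σ ≤ x₀, that is, Y ≥ 0.
  set Y : Matrix (Fin d) (Fin d) ℂ := x₀ • (1 : Matrix (Fin d) (Fin d) ℂ) - (L - σ) with hYdef
  have hquadY : ∀ x, quad Y x = x₀ * ‖x‖ ^ 2 - (quad L x - quad σ x) := by
    intro x
    rw [hYdef, quad_sub, quad_smul, quad_one, quad_sub]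
  have hYherm : Y.IsHermitian :=
    (Matrix.isHermitian_one.smul (IsSelfAdjoint.all x₀)).sub hM
  have hMle : ∀ z, ‖z‖ = 1 → quad (L - σ) z ≤ x₀ := by
    intro z hz
    have h1 := h.frobeniusInner_le (isState_rankOne hz)
    have h2 : frobeniusInner (L - σ) (rankOne z - σ) =
        frobeniusInner (L - σ) (rankOne z) - x₀ := by
      simp [frobeniusInner, mul_sub, hx₀]
    rw [h2, frobeniusInner_rankOne hM] at h1
    linarith
  have hY0 : ∀ x, 0 ≤ quad Y x := by
    intro x
    have := quad_le_of_unit hMle x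
    rw [quad_sub] at this
    rw [hquadY]
    linarith
  have hY := posSemidef_of_quad_nonneg hYherm hY0
  set b := hσ.eigenvectorBasis
  set r := hσ.eigenvalues
  have hb : ∀ j, ‖b j‖ = 1 := b.orthonormal.1
  have hr0 : ∀ j, 0 ≤ r j := h.1.1.eigenvalues_nonneg
  have hquadσ : ∀ j, quad σ (b j) = r j := quad_eigenvectorBasis hσ
  have hrsum : ∑ j, r j = 1 := by
    rw [← h.1.trace_re, ← sum_quad_basis σ b]
    exact Finset.sum_congr rfl fun j _ => (hquadσ j).symm
  have hx₀sum : x₀ = ∑ j, r j * quad (L - σ) (b j) := by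
    rw [hx₀, frobeniusInner, hM.eq, ← sum_quad_basis _ b]
    exact Finset.sum_congr rfl fun j _ => quad_mul_eigenvector hσ _ j
  -- Complementary slackness: tr(Yσ) = x₀ - x₀ = 0 is a sum of nonnegative terms.
  have hrY : ∀ j, r j * quad Y (b j) = 0 := by
    have hsum : ∑ j, r j * quad Y (b j) = 0 := by
      have : ∀ j, r j * quad Y (b j) = r j * x₀ - r j * quad (L - σ) (b j) := by
        intro j
        rw [hquadY, hb, quad_sub]
        ring
      simp_rw [this]
      rw [Finset.sum_sub_distrib, ← Finset.sum_mul, hrsum, ← hx₀sum, one_mul, sub_self]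
    intro j
    exact (Finset.sum_eq_zero_iff_of_nonneg fun j _ => mul_nonneg (hr0 j) (hY0 _)).1 hsum j
      (Finset.mem_univ j)
  have hYb : ∀ j, r j ≠ 0 → Y.mulVec (b j).ofLp = 0 := by
    intro j hj
    have h1 : quad Y (b j) = 0 := (mul_eq_zero.1 (hrY j)).resolve_left hj
    refine (hY.dotProduct_mulVec_zero_iff _).1 (Complex.ext h1 ?_)
    exact hYherm.im_star_dotProduct_mulVec_self _
  have hLρ : ∀ z, ‖z‖ = 1 → quad L z - quad ρ z ≤ τ ∧ quad ρ z - quad L z ≤ τ := by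
    intro z hz
    have := abs_le.1 (hτ z hz)
    rw [quad_sub] at this
    constructor <;> linarith
  -- Where r j ≠ 0 the form of L at b j is r j + x₀. If x₀ > τ, the form of ρ would exceed r j at
  -- all such j, forcing tr ρ > 1.
  have hx₀τ : x₀ ≤ τ := by
    by_contra hcon
    push Not at hcon
    have hlt : ∀ j, r j ≠ 0 → r j < quad ρ (b j) := by
      intro j hj
      have h1 : quad Y (b j) = 0 := (mul_eq_zero.1 (hrY j)).resolve_left hj
      rw [hquadY, hb, hquadσ] at h1
      have := (hLρ _ (hb j)).1
      linarith
    obtain ⟨j, -, hj⟩ : ∃ j ∈ Finset.univ, r j ≠ 0 :=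
      Finset.exists_ne_zero_of_sum_ne_zero (by rw [hrsum]; exact one_ne_zero)
    have hsum : ∑ j, r j < ∑ j, quad ρ (b j) := by
      refine Finset.sum_lt_sum (fun i _ => ?_) ⟨j, Finset.mem_univ j, hlt j hj⟩
      by_cases hi : r i = 0
      · rw [hi]; exact quad_nonneg hρ.1 _
      · exact (hlt i hi).le
    rw [hrsum, sum_quad_basis, hρ.trace_re] at hsum
    exact lt_irrefl _ hsum
  have hτ0 : 0 ≤ τ := (abs_nonneg _).trans (hτ z hz)
  -- Here the normalization of L enters: tr L = tr σ makes tr Y = d x₀.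
  have hx₀0 : 0 ≤ x₀ := by
    have h1 : 0 ≤ ∑ j, quad Y (b j) := Finset.sum_nonneg fun j _ => hY0 _
    simp_rw [hquadY, hb] at h1
    rw [Finset.sum_sub_distrib, Finset.sum_sub_distrib, sum_quad_basis, sum_quad_basis, htr,
      h.1.trace_re] at h1
    have hd : 0 < d := by
      rcases Nat.eq_zero_or_pos d with rfl | hd
      · simp at hrsum
      · exact hd
    simp at h1
    exact (mul_nonneg_iff_of_pos_left (by exact_mod_cast hd)).1 h1
  -- Y kills the eigenvectors of σ with nonzero eigenvalue, so an eigenvector w of Y with positive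
  -- eigenvalue has ⟨w|σ|w⟩ = 0. The eigenvalue is then x₀ - ⟨w|L|w⟩, and ρ ≥ 0 bounds it.
  have hYle : ∀ j, hYherm.eigenvalues j ≤ x₀ + τ := by
    intro j
    rcases le_or_gt (hYherm.eigenvalues j) 0 with hy | hy
    · linarith
    · set w := hYherm.eigenvectorBasis j with hw
      have hw1 : ‖w‖ = 1 := hYherm.eigenvectorBasis.orthonormal.1 j
      have hYw := quad_eigenvectorBasis hYherm j
      have hσw : quad σ w = 0 := by
        rw [quad_eq_sum_eigenvalues hσ]
        refine Finset.sum_eq_zero fun k _ => ?_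
        by_cases hk : r k = 0
        · rw [show hσ.eigenvalues k = 0 from hk, zero_mul]
        · have hsymm := (Matrix.isSymmetric_toEuclideanLin_iff.2 hYherm) (b k) w
          have h1 : Matrix.toEuclideanLin Y (b k) = 0 := by
            rw [Matrix.toLpLin_apply, hYb k hk]; rfl
          have h2 : Matrix.toEuclideanLin Y w = (hYherm.eigenvalues j : ℂ) • w := by
            rw [Matrix.toLpLin_apply, hw, hYherm.mulVec_eigenvectorBasis]; rfl
          rw [h1, h2, inner_zero_left, inner_smul_right, eq_comm, mul_eq_zero] at hsymm
          rcases hsymm with h3 | h3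
          · exact absurd (Complex.ofReal_eq_zero.1 h3) hy.ne'
          · rw [show inner ℂ (hσ.eigenvectorBasis k) w = 0 from h3]; simp
      rw [← hw, hquadY, hw1, hσw] at hYw
      have h1 := (hLρ w hw1).2
      have h2 := quad_nonneg hρ.1 w
      linarith
  have hYz : quad Y z ≤ x₀ + τ := by
    rw [quad_eq_sum_eigenvalues hYherm]
    calc _ ≤ ∑ j, (x₀ + τ) * ‖inner ℂ (hYherm.eigenvectorBasis j) z‖ ^ 2 :=
          Finset.sum_le_sum fun j _ => by gcongr; exact hYle j
      _ = _ := by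
        rw [← Finset.mul_sum, hYherm.eigenvectorBasis.sum_sq_norm_inner_right, hz]
        ring
  -- Conclusion from σ - ρ = (L - ρ) + (Y - x₀), where -τ ≤ -x₀ ≤ Y - x₀ ≤ τ.
  have h1 := hLρ z hz
  have h2 := hY0 z
  rw [hquadY, hz] at hYz h2
  rw [quad_sub, abs_le]
  constructor <;> linarith

/-! ### Trace norm and rank -/

/-- The eigenvalues of A² are compared as a multiset of characteristic roots, since the two
indexings need not agree. -/
theorem traceNorm_eq_sum_abs_eigenvalues {d : ℕ} {A : Matrix (Fin d) (Fin d) ℂ}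
    (hA : A.IsHermitian) : traceNorm A = ∑ i, |hA.eigenvalues i| := by
  have hB := Matrix.isHermitian_conjTranspose_mul_self A
  have h1 : (A.conjTranspose * A).charpoly =
      ∏ i, (Polynomial.X - Polynomial.C ((hA.eigenvalues i ^ 2 : ℝ) : ℂ)) := by
    rw [hA.eq]
    conv_lhs => rw [hA.spectral_theorem, ← map_mul, Unitary.conjStarAlgAut_apply,
      Matrix.charpoly_mul_comm, ← mul_assoc]
    simp [Matrix.charpoly_diagonal, Matrix.diagonal_mul_diagonal, sq]
  have h2 := hB.roots_charpoly_eq_eigenvalues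
  rw [h1, Polynomial.roots_prod _ _
    (Finset.prod_ne_zero_iff.2 fun i _ => Polynomial.X_sub_C_ne_zero _)] at h2
  simp only [Polynomial.roots_X_sub_C, Multiset.bind_singleton] at h2
  have h3 := congrArg (fun m => (m.map fun w : ℂ => Real.sqrt w.re).sum) h2
  simp only [Multiset.map_map, Function.comp_def, Complex.ofReal_re, Real.sqrt_sq_eq_abs] at h3
  exact h3.symm

/-- The number of positive eigenvalues of `σ - ρ` is at most the rank of `σ`. -/
theorem card_pos_eigenvalues_le_rank {d : ℕ} {σ ρ : Matrix (Fin d) (Fin d) ℂ}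
    (hρ : ρ.PosSemidef) (hA : (σ - ρ).IsHermitian) :
    (Finset.univ.filter fun i => 0 < hA.eigenvalues i).card ≤ σ.rank := by
  set b := hA.eigenvectorBasis
  let I := {i // 0 < hA.eigenvalues i}
  let T : (I → ℂ) →ₗ[ℂ] EuclideanSpace ℂ (Fin d) :=
    Fintype.linearCombination ℂ (fun i : I => b i.1)
  let S : (I → ℂ) →ₗ[ℂ] LinearMap.range σ.mulVecLin :=
    σ.mulVecLin.rangeRestrict ∘ₗ (WithLp.linearEquiv 2 ℂ (Fin d → ℂ)).toLinearMap ∘ₗ T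
  -- On the span of the positive eigenvectors, σ ≥ σ - ρ is positive definite, so σ is injective
  -- there.
  have hS : Function.Injective S := by
    rw [← LinearMap.ker_eq_bot, LinearMap.ker_eq_bot']
    intro c hc
    have h1 : σ.mulVec (T c).ofLp = 0 := congrArg Subtype.val hc
    have h2 : quad σ (T c) = 0 := by rw [quad, h1]; simp
    have hinner : ∀ j : I, inner ℂ (b j.1) (T c) = c j := by
      intro j
      simp only [T, Fintype.linearCombination_apply, inner_sum, inner_smul_right,
        orthonormal_iff_ite.1 b.orthonormal]
      rw [Finset.sum_eq_single j]
      · simp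
      · intro k _ hk
        rw [if_neg fun h => hk (Subtype.ext h.symm), mul_zero]
      · simp
    have hinner' : ∀ j, ¬ 0 < hA.eigenvalues j → inner ℂ (b j) (T c) = 0 := by
      intro j hj
      simp only [T, Fintype.linearCombination_apply, inner_sum, inner_smul_right,
        orthonormal_iff_ite.1 b.orthonormal]
      refine Finset.sum_eq_zero fun k _ => ?_
      rw [if_neg fun h : j = k.1 => hj (h ▸ k.2), mul_zero]
    have hnn : ∀ j, 0 ≤ hA.eigenvalues j * ‖inner ℂ (b j) (T c)‖ ^ 2 := by
      intro j
      by_cases hj : 0 < hA.eigenvalues j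
      · positivity
      · rw [hinner' j hj]; simp
    have h3 : ∑ j, hA.eigenvalues j * ‖inner ℂ (b j) (T c)‖ ^ 2 = 0 := by
      refine le_antisymm ?_ (Finset.sum_nonneg fun j _ => hnn j)
      rw [← quad_eq_sum_eigenvalues hA, quad_sub, h2]
      linarith [quad_nonneg hρ (T c)]
    ext j
    have h4 := (Finset.sum_eq_zero_iff_of_nonneg fun j _ => hnn j).1 h3 j.1 (Finset.mem_univ _)
    rw [hinner j] at h4
    simpa [j.2.ne'] using h4
  have h := LinearMap.finrank_le_finrank_of_injective hS
  rw [Module.finrank_fintype_fun_eq_card, Fintype.card_subtype] at h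
  exact h

/-- Reals with zero sum and absolute values at most `c`, at most `r` of them positive, have absolute
sum at most `2 * r * c`. -/
theorem sum_abs_le_of_sum_eq_zero {ι : Type*} [Fintype ι] {a : ι → ℝ} {c : ℝ}
    (h0 : ∑ i, a i = 0) (hc : ∀ i, |a i| ≤ c) {r : ℕ}
    (hr : (Finset.univ.filter fun i => 0 < a i).card ≤ r) (hc0 : 0 ≤ c) :
    ∑ i, |a i| ≤ r * (2 * c) := by
  -- Since |a| is twice the positive part minus a, and the a i sum to zero, only the positive
  -- entries count.
  have h1 : ∑ i, |a i| = ∑ i, if 0 < a i then 2 * a i else 0 := by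
    have : ∀ i, |a i| = (if 0 < a i then 2 * a i else 0) - a i := by
      intro i
      split_ifs with h
      · rw [abs_of_pos h]; ring
      · rw [abs_of_nonpos (not_lt.1 h)]; ring
    simp_rw [this]
    rw [Finset.sum_sub_distrib, h0, sub_zero]
  rw [h1, ← Finset.sum_filter]
  calc _ ≤ ∑ i ∈ Finset.univ.filter (fun i => 0 < a i), 2 * c :=
        Finset.sum_le_sum fun i _ => by linarith [(abs_le.1 (hc i)).2]
    _ = (Finset.univ.filter fun i => 0 < a i).card * (2 * c) := by
        rw [Finset.sum_const, nsmul_eq_mul]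
    _ ≤ _ := by gcongr

theorem traceNorm_sub_comm {d : ℕ} (A B : Matrix (Fin d) (Fin d) ℂ) :
    traceNorm (A - B) = traceNorm (B - A) := by
  have h : (A - B).conjTranspose * (A - B) = (B - A).conjTranspose * (B - A) := by
    rw [← neg_sub B A, Matrix.conjTranspose_neg, neg_mul_neg]
  unfold traceNorm
  congr! 3

theorem traceNorm_sub_le_rank {d : ℕ} {σ ρ : Matrix (Fin d) (Fin d) ℂ} (hσ : IsState σ)
    (hρ : IsState ρ) {c : ℝ} (hc : ∀ z, ‖z‖ = 1 → |quad (σ - ρ) z| ≤ c) (hc0 : 0 ≤ c) :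
    traceNorm (σ - ρ) ≤ σ.rank * (2 * c) := by
  have hA : (σ - ρ).IsHermitian := hσ.1.isHermitian.sub hρ.1.isHermitian
  rw [traceNorm_eq_sum_abs_eigenvalues hA]
  refine sum_abs_le_of_sum_eq_zero ?_ (fun i => ?_) (card_pos_eigenvalues_le_rank hρ.1 hA) hc0
  · simp_rw [← quad_eigenvectorBasis hA]
    rw [sum_quad_basis, Matrix.trace_sub, hσ.2, hρ.2, sub_self, Complex.zero_re]
  · rw [← quad_eigenvectorBasis hA]
    exact hc _ (hA.eigenvectorBasis.orthonormal.1 i)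

theorem traceNorm_sub_le_min_rank {d : ℕ} {σ ρ : Matrix (Fin d) (Fin d) ℂ} (hσ : IsState σ)
    (hρ : IsState ρ) {c : ℝ} (hc : ∀ z, ‖z‖ = 1 → |quad (σ - ρ) z| ≤ c) (hc0 : 0 ≤ c) :
    traceNorm (σ - ρ) ≤ (min ρ.rank σ.rank : ℕ) * (2 * c) := by
  rcases min_choice ρ.rank σ.rank with h | h <;> rw [h]
  · rw [traceNorm_sub_comm]
    refine traceNorm_sub_le_rank hρ hσ (fun z hz => ?_) hc0
    rw [quad_sub, abs_sub_comm, ← quad_sub]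
    exact hc z hz
  · exact traceNorm_sub_le_rank hσ hρ hc hc0

/-- This disposes of t > 2, which the small-parameter Chernoff bound does not cover. -/
theorem traceNorm_sub_le_two {d : ℕ} {σ ρ : Matrix (Fin d) (Fin d) ℂ} (hσ : IsState σ)
    (hρ : IsState ρ) : traceNorm (σ - ρ) ≤ 2 := by
  have hA : (σ - ρ).IsHermitian := hσ.1.isHermitian.sub hρ.1.isHermitian
  rw [traceNorm_eq_sum_abs_eigenvalues hA]
  calc ∑ i, |hA.eigenvalues i|
      ≤ ∑ i, (quad σ (hA.eigenvectorBasis i) + quad ρ (hA.eigenvectorBasis i)) := by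
        refine Finset.sum_le_sum fun i _ => ?_
        rw [← quad_eigenvectorBasis hA, quad_sub, abs_le]
        have h1 := quad_nonneg hσ.1 (hA.eigenvectorBasis i)
        have h2 := quad_nonneg hρ.1 (hA.eigenvectorBasis i)
        constructor <;> linarith
    _ = 2 := by
      rw [Finset.sum_add_distrib, sum_quad_basis, sum_quad_basis, hσ.trace_re, hρ.trace_re]
      norm_num

theorem IsState.rank_pos {d : ℕ} {σ : Matrix (Fin d) (Fin d) ℂ} (hσ : IsState σ) :
    0 < σ.rank := by
  rw [Nat.pos_iff_ne_zero]
  intro h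
  have h0 : σ = 0 := by
    rw [Matrix.rank, Submodule.finrank_eq_zero, LinearMap.range_eq_bot] at h
    exact Matrix.toLin'.injective (h.trans (map_zero _).symm)
  have := hσ.2
  simp [h0] at this

/-! ### Nets on the unit sphere -/

/-- The number of `1/4`-separated unit vectors is at most `9 ^ dim`. -/
theorem card_le_of_quarter_separated {E : Type*} [NormedAddCommGroup E] [NormedSpace ℝ E]
    [FiniteDimensional ℝ E] (s : Finset E) (hs : ∀ c ∈ s, ‖c‖ = 1)
    (h : (s : Set E).Pairwise fun c e => 1 / 4 ≤ ‖c - e‖) :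
    s.card ≤ 9 ^ Module.finrank ℝ E := by
  borelize E
  let μ : Measure E := Measure.addHaar
  -- Volume comparison: disjoint balls of radius 1/8 inside a ball of radius 9/8.
  have hdisj : Set.PairwiseDisjoint (s : Set E) fun c => Metric.ball c (1 / 8 : ℝ) := by
    intro c hc e he hce
    apply Metric.ball_disjoint_ball
    rw [dist_eq_norm]
    have := h hc he hce
    linarith
  have hsub : (⋃ c ∈ s, Metric.ball c (1 / 8 : ℝ)) ⊆ Metric.ball (0 : E) (9 / 8) := by
    refine Set.iUnion₂_subset fun x hx => Metric.ball_subset_ball' ?_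
    rw [dist_zero_right, hs x hx]
    norm_num
  have h1 := measureReal_mono (μ := μ) hsub measure_ball_lt_top.ne
  rw [measureReal_biUnion_finset hdisj (fun c _ => measurableSet_ball)
    (fun c _ => measure_ball_lt_top.ne)] at h1
  have hball : ∀ (c : E) (r : ℝ), 0 < r → μ.real (Metric.ball c r) =
      r ^ Module.finrank ℝ E * μ.real (Metric.ball 0 1) := by
    intro c r hr
    rw [measureReal_def, μ.addHaar_ball_of_pos _ hr, ENNReal.toReal_mul,
      ENNReal.toReal_ofReal (by positivity), measureReal_def]
  simp only [hball _ (1 / 8) (by norm_num), hball _ (9 / 8) (by norm_num), Finset.sum_const,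
    nsmul_eq_mul] at h1
  have hpos : 0 < μ.real (Metric.ball (0 : E) 1) :=
    ENNReal.toReal_pos (Metric.measure_ball_pos _ _ one_pos).ne' measure_ball_lt_top.ne
  rw [← mul_assoc, mul_le_mul_iff_left₀ hpos, show (9 / 8 : ℝ) = 9 * (1 / 8) by norm_num, mul_pow,
    mul_le_mul_iff_left₀ (by positivity)] at h1
  exact_mod_cast h1

/-- The unit sphere has a `1/4`-net of cardinality at most `9 ^ dim`. -/
theorem exists_quarter_net (E : Type*) [NormedAddCommGroup E] [NormedSpace ℝ E]
    [FiniteDimensional ℝ E] :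
    ∃ s : Finset E, (∀ c ∈ s, ‖c‖ = 1) ∧ s.card ≤ 9 ^ Module.finrank ℝ E ∧
      ∀ z : E, ‖z‖ = 1 → ∃ y ∈ s, ‖z - y‖ < 1 / 4 := by
  classical
  -- A separated set of greatest cardinality, which exists by the volume bound, must be a net.
  let Q : ℕ → Prop := fun m => ∃ s : Finset E, s.card = m ∧ (∀ c ∈ s, ‖c‖ = 1) ∧
    (s : Set E).Pairwise fun c e => 1 / 4 ≤ ‖c - e‖
  have hbound : ∀ m, Q m → m ≤ 9 ^ Module.finrank ℝ E := by
    rintro m ⟨s, rfl, hs1, hs2⟩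
    exact card_le_of_quarter_separated s hs1 hs2
  have hQ0 : Q 0 := ⟨∅, by simp⟩
  obtain ⟨s, hcard, hs1, hs2⟩ := Nat.findGreatest_spec (P := Q) (Nat.zero_le _) hQ0
  refine ⟨s, hs1, card_le_of_quarter_separated s hs1 hs2, fun z hz => ?_⟩
  by_contra hcon
  push Not at hcon
  have hzs : z ∉ s := fun hmem => by
    have := hcon z hmem
    norm_num at this
  have hnew : Q (s.card + 1) := by
    refine ⟨insert z s, Finset.card_insert_of_notMem hzs, fun c hc => ?_, ?_⟩
    · rcases Finset.mem_insert.1 hc with rfl | hc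
      · exact hz
      · exact hs1 c hc
    · rw [Finset.coe_insert]
      refine hs2.insert fun y hy _ => ⟨hcon y hy, ?_⟩
      rw [norm_sub_rev]
      exact hcon y hy
  have := Nat.le_findGreatest (P := Q) (hbound (s.card + 1) hnew) hnew
  exact absurd (this.trans_eq hcard.symm) (Nat.not_succ_le_self _)

theorem norm_inner_sq_ge {d : ℕ} {w y : EuclideanSpace ℂ (Fin d)} (hw : ‖w‖ = 1) (hy : ‖y‖ = 1)
    (h : ‖w - y‖ < 1 / 4) : 15 / 16 ≤ ‖inner ℂ w y‖ ^ 2 := by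
  have h1 := norm_sub_sq (𝕜 := ℂ) w y
  rw [hw, hy, RCLike.re_eq_complex_re] at h1
  have h2 : ‖w - y‖ ^ 2 ≤ 1 / 16 := by nlinarith [norm_nonneg (w - y)]
  have h3 : 31 / 32 ≤ (inner ℂ w y).re := by linarith
  have h4 := h3.trans (Complex.re_le_norm _)
  nlinarith

/-- The operator norm of a hermitian matrix is attained up to a constant on a `1/4`-net. -/
theorem exists_mem_net_quad_ge {d : ℕ} [NeZero d] {A : Matrix (Fin d) (Fin d) ℂ}
    (hA : A.IsHermitian) {s : Finset (EuclideanSpace ℂ (Fin d))} (hs : ∀ c ∈ s, ‖c‖ = 1)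
    (hnet : ∀ z : EuclideanSpace ℂ (Fin d), ‖z‖ = 1 → ∃ y ∈ s, ‖z - y‖ < 1 / 4) :
    ∃ m : ℝ, 0 ≤ m ∧ (∀ z, ‖z‖ = 1 → |quad A z| ≤ m) ∧ ∃ y ∈ s, 7 / 8 * m ≤ |quad A y| := by
  obtain ⟨j, hj⟩ := Finite.exists_max fun i => |hA.eigenvalues i|
  set b := hA.eigenvectorBasis
  set m := |hA.eigenvalues j| with hm
  have hm0 : 0 ≤ m := abs_nonneg _
  refine ⟨m, hm0, fun z hz => ?_, ?_⟩
  · rw [quad_eq_sum_eigenvalues hA]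
    calc _ ≤ ∑ i, |hA.eigenvalues i * ‖inner ℂ (b i) z‖ ^ 2| := Finset.abs_sum_le_sum_abs _ _
      _ ≤ ∑ i, m * ‖inner ℂ (b i) z‖ ^ 2 := by
        refine Finset.sum_le_sum fun i _ => ?_
        rw [abs_mul, abs_of_nonneg (sq_nonneg ‖inner ℂ (b i) z‖)]
        gcongr
        exact hj i
      _ = m := by rw [← Finset.mul_sum, b.sum_sq_norm_inner_right, hz]; ring
  · obtain ⟨y, hy, hyn⟩ := hnet (b j) (b.orthonormal.1 j)
    refine ⟨y, hy, ?_⟩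
    have hq := norm_inner_sq_ge (b.orthonormal.1 j) (hs y hy) hyn
    have hsum := b.sum_sq_norm_inner_right y
    rw [hs y hy, ← Finset.add_sum_erase _ _ (Finset.mem_univ j)] at hsum
    rw [quad_eq_sum_eigenvalues hA, ← Finset.add_sum_erase _ _ (Finset.mem_univ j)]
    set q := ‖inner ℂ (b j) y‖ ^ 2
    have hrest : |∑ i ∈ Finset.univ.erase j, hA.eigenvalues i * ‖inner ℂ (b i) y‖ ^ 2| ≤
        m * (1 - q) := by
      calc _ ≤ ∑ i ∈ Finset.univ.erase j, |hA.eigenvalues i * ‖inner ℂ (b i) y‖ ^ 2| :=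
            Finset.abs_sum_le_sum_abs _ _
        _ ≤ ∑ i ∈ Finset.univ.erase j, m * ‖inner ℂ (b i) y‖ ^ 2 := by
          refine Finset.sum_le_sum fun i _ => ?_
          rw [abs_mul, abs_of_nonneg (sq_nonneg ‖inner ℂ (b i) y‖)]
          gcongr
          exact hj i
        _ = m * (1 - q) := by rw [← Finset.mul_sum]; congr 1; linarith
    have hmain : |hA.eigenvalues j * q| = m * q := by
      rw [abs_mul, abs_of_nonneg (sq_nonneg _ : 0 ≤ q)]
    -- The dominant eigenvector contributes mq and the others at most m(1-q); q ≥ 15/16 leaves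
    -- m(2q-1) ≥ 7m/8.
    have htri := abs_sub_abs_le_abs_sub (hA.eigenvalues j * q)
      (-∑ i ∈ Finset.univ.erase j, hA.eigenvalues i * ‖inner ℂ (b i) y‖ ^ 2)
    rw [abs_neg, sub_neg_eq_add, hmain] at htri
    nlinarith

/-! ### Chernoff bounds for a fixed direction -/

section Concentration

variable {d n : ℕ} {Ω : Type*} [MeasurableSpace Ω] {P : Measure Ω} [IsProbabilityMeasure P]
  {ρ : Matrix (Fin (d + 1)) (Fin (d + 1)) ℂ} {v : Fin n → Ω → Sphere (d + 1)}

/-- Chernoff bound for one direction and one sign. -/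
theorem measureReal_le_sum_overlap_le (hρ : IsState ρ) (hv : IsUniformPOVMSample ρ P v)
    {z : EuclideanSpace ℂ (Fin (d + 1))} (hz : ‖z‖ = 1) {s : ℝ} (hs : |s| = 1) {θ : ℝ}
    (h0 : 0 ≤ θ) (hθ : θ ≤ 1 / 8) (c : ℝ) :
    P.real {ω | c ≤ ∑ i, s * (scaledOverlap z (v i ω) - (1 + quad ρ z))} ≤
      Real.exp (-θ * c + n * (2 * θ ^ 2)) := by
  set f : Sphere (d + 1) → ℝ := fun w => s * (scaledOverlap z w - (1 + quad ρ z))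
  have hf : Continuous f := by
    have := continuous_scaledOverlap z
    fun_prop
  have hmeas : ∀ i, AEMeasurable (fun ω => f (v i ω)) P := fun i =>
    hf.measurable.comp_aemeasurable (hv.law i).aemeasurable
  have hindep : iIndepFun (fun i ω => f (v i ω)) P :=
    hv.indep.comp (fun _ => f) fun _ => hf.measurable
  obtain ⟨B, hB⟩ : ∃ B, ∀ w, |f w| ≤ B := by
    obtain ⟨B, hB⟩ := isCompact_univ.exists_bound_of_continuousOn hf.continuousOn
    exact ⟨B, fun w => hB w (Set.mem_univ w)⟩
  have hint : Integrable (fun ω => Real.exp (θ * (∑ i, fun ω => f (v i ω)) ω)) P := by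
    refine Integrable.of_bound (C := Real.exp (θ * ∑ _i : Fin n, B)) ?_ (.of_forall fun ω => ?_)
    · exact (((Finset.aemeasurable_sum _ fun i _ => hmeas i).const_mul θ).exp).aestronglyMeasurable
    · rw [Real.norm_of_nonneg (Real.exp_pos _).le, Finset.sum_apply]
      gcongr with i
      exact (le_abs_self _).trans (hB _)
  have hch := measure_ge_le_exp_mul_mgf c h0 hint
  have hmgf : ∀ i, mgf (fun ω => f (v i ω)) P θ ≤ Real.exp (2 * θ ^ 2) := by
    intro i
    have hg : Continuous fun w => Real.exp (θ * f w) := by fun_prop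
    have h1 : mgf (fun ω => f (v i ω)) P θ = ∫ w, Real.exp (θ * f w) ∂(bornMeasure ρ) :=
      (hv.law i).integral_comp hg.aestronglyMeasurable
    have hs2 : s ^ 2 = 1 := by rw [← sq_abs, hs, one_pow]
    have h2 := integral_exp_centered_le hρ hz (θ := θ * s) (by
      rw [abs_mul, hs, mul_one, abs_of_nonneg h0]; exact hθ)
    rw [mul_pow, hs2, mul_one] at h2
    rw [h1]
    simpa only [f, mul_assoc] using h2
  rw [hindep.mgf_sum₀ hmeas] at hch
  simp only [Finset.sum_apply] at hch
  refine hch.trans ?_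
  rw [Real.exp_add]
  gcongr
  calc _ ≤ ∏ _i : Fin n, Real.exp (2 * θ ^ 2) :=
        Finset.prod_le_prod (fun i _ => mgf_nonneg) fun i _ => hmgf i
    _ = _ := by simp [← Real.exp_nat_mul]

/-- The deviation of the empirical overlap from its mean. -/
def deviation (ρ : Matrix (Fin (d + 1)) (Fin (d + 1)) ℂ) (v : Fin n → Sphere (d + 1))
    (z : EuclideanSpace ℂ (Fin (d + 1))) : ℝ :=
  (1 / n : ℝ) * ∑ i, scaledOverlap z (v i) - (1 + quad ρ z)

theorem measureReal_le_abs_deviation_le (hn : 0 < n) (hρ : IsState ρ)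
    (hv : IsUniformPOVMSample ρ P v) {z : EuclideanSpace ℂ (Fin (d + 1))} (hz : ‖z‖ = 1) {τ : ℝ}
    (h0 : 0 ≤ τ) (h1 : τ ≤ 1 / 2) :
    P.real {ω | 7 / 8 * τ ≤ |deviation ρ (fun i => v i ω) z|} ≤
      2 * Real.exp (-(49 / 512 * (n * τ ^ 2))) := by
  have hn' : (0 : ℝ) < n := by exact_mod_cast hn
  have hdev : ∀ ω, n * deviation ρ (fun i => v i ω) z =
      ∑ i, (scaledOverlap z (v i ω) - (1 + quad ρ z)) := by
    intro ω
    rw [deviation, Finset.sum_sub_distrib, mul_sub, ← mul_assoc, mul_one_div_cancel hn'.ne']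
    simp [mul_add]
  have hsub : {ω | 7 / 8 * τ ≤ |deviation ρ (fun i => v i ω) z|} ⊆
      {ω | n * (7 / 8 * τ) ≤ ∑ i, (1 : ℝ) * (scaledOverlap z (v i ω) - (1 + quad ρ z))} ∪
      {ω | n * (7 / 8 * τ) ≤ ∑ i, (-1 : ℝ) * (scaledOverlap z (v i ω) - (1 + quad ρ z))} := by
    intro ω hω
    simp only [Set.mem_ofPred_eq, Set.mem_union, ← Finset.mul_sum, ← hdev] at hω ⊢
    rcases le_abs.1 hω with h | h
    · left; rw [one_mul]; gcongr
    · right; rw [neg_one_mul, ← mul_neg]; gcongr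
  -- The value θ = 7τ/32 minimizes the Chernoff exponent at threshold 7nτ/8, and τ ≤ 1/2 keeps it
  -- below 1/8.
  have hexp : -(7 / 32 * τ) * (n * (7 / 8 * τ)) + n * (2 * (7 / 32 * τ) ^ 2) =
      -(49 / 512 * (n * τ ^ 2)) := by ring
  have hb : ∀ s : ℝ, |s| = 1 →
      P.real {ω | n * (7 / 8 * τ) ≤ ∑ i, s * (scaledOverlap z (v i ω) - (1 + quad ρ z))} ≤
        Real.exp (-(49 / 512 * (n * τ ^ 2))) := by
    intro s hs
    rw [← hexp]
    exact measureReal_le_sum_overlap_le hρ hv hz hs (by positivity) (by linarith) _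
  calc _ ≤ _ := measureReal_mono hsub
    _ ≤ _ := measureReal_union_le _ _
    _ ≤ Real.exp (-(49 / 512 * (n * τ ^ 2))) + Real.exp (-(49 / 512 * (n * τ ^ 2))) :=
      add_le_add (hb 1 (by simp)) (hb (-1) (by simp))
    _ = _ := by ring

end Concentration

/-! ### Union bound and constants -/

/-- With D = d + 1, the prefactor is at most exp(6D), more than exp(2.2D) allows, but the rate
49/512 beats 1/30. Unless the claim is trivial from p ≤ 1, x > 66D and the surplus rate pays for the
missing 3.8D. -/
theorem exp_bound {d : ℕ} {x p : ℝ} (hp1 : p ≤ 1)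
    (hp : p ≤ 81 ^ (d + 1) * (2 * Real.exp (-(49 / 512 * x)))) :
    p ≤ Real.exp (2.2 * (d + 1 : ℕ) - x / 30) := by
  rcases le_or_gt (x / 30) (2.2 * (d + 1 : ℕ)) with h | h
  · refine hp1.trans (Real.one_le_exp ?_)
    linarith
  · refine hp.trans ?_
    have h6 : (162 : ℝ) ≤ Real.exp 6 := by
      have h1 := Real.exp_one_gt_d9
      rw [show (6 : ℝ) = (6 : ℕ) * 1 by norm_num, Real.exp_nat_mul]
      calc (162 : ℝ) ≤ 2.7 ^ 6 := by norm_num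
        _ ≤ _ := by gcongr; linarith
    have h2 : (81 : ℝ) ^ (d + 1) * 2 ≤ Real.exp (6 * (d + 1 : ℕ)) := by
      calc (81 : ℝ) ^ (d + 1) * 2 ≤ 81 ^ (d + 1) * 2 ^ (d + 1) := by
            gcongr
            exact le_self_pow₀ one_le_two (by omega)
        _ = 162 ^ (d + 1) := by rw [← mul_pow]; norm_num
        _ ≤ Real.exp 6 ^ (d + 1) := by gcongr
        _ = _ := by rw [← Real.exp_nat_mul, mul_comm]
    rw [← mul_assoc]
    calc _ ≤ Real.exp (6 * (d + 1 : ℕ)) * Real.exp (-(49 / 512 * x)) := by gcongr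
      _ ≤ _ := by
        rw [← Real.exp_add]
        gcongr
        have hd : (0 : ℝ) ≤ ((d + 1 : ℕ) : ℝ) := Nat.cast_nonneg _
        norm_num at h ⊢
        linarith

/-- This is the deterministic half of the argument. The net is chosen before the data, as a union
bound requires; 81 = 9² because the real dimension is twice the complex one, and 4 is 2 from the
projection times 2 from trace zero. -/
theorem exists_deviation_net (d n : ℕ) (hn : 0 < n) :
    ∃ s : Finset (EuclideanSpace ℂ (Fin (d + 1))), (∀ y ∈ s, ‖y‖ = 1) ∧ s.card ≤ 81 ^ (d + 1) ∧
      ∀ (ρ : Matrix (Fin (d + 1)) (Fin (d + 1)) ℂ) (_ : IsState ρ) (v : Fin n → Sphere (d + 1))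
        (σ : Matrix (Fin (d + 1)) (Fin (d + 1)) ℂ) (_ : IsPLSEstimator v σ),
        ∃ m : ℝ, 0 ≤ m ∧ traceNorm (σ - ρ) ≤ (min ρ.rank σ.rank : ℕ) * (4 * m) ∧
          ∃ y ∈ s, 7 / 8 * m ≤ |deviation ρ v y| := by
  obtain ⟨s, hs1, hs2, hnet⟩ := exists_quarter_net (EuclideanSpace ℂ (Fin (d + 1)))
  refine ⟨s, hs1, ?_, fun ρ hρ v σ ⟨L, hL, hproj⟩ => ?_⟩
  · rw [finrank_real_of_complex, finrank_euclideanSpace_fin, pow_mul] at hs2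
    norm_num at hs2
    exact hs2
  · obtain ⟨m, hm0, hm, y, hy, hmy⟩ :=
      exists_mem_net_quad_ge (hL.1.sub hρ.1.isHermitian) hs1 hnet
    refine ⟨m, hm0, ?_, y, hy, ?_⟩
    · refine (traceNorm_sub_le_min_rank hproj.1 hρ (c := 2 * m)
        (fun z hz => hproj.abs_quad_sub_le hL.1 (hL.trace_re hn) hρ hm hz)
        (by positivity)).trans_eq ?_
      ring
    · rwa [quad_sub, hL.quad_eq hn (hs1 y hy), sub_sub] at hmy

theorem measureReal_rank_mul_le_traceNorm_le {d n : ℕ} (hn : 0 < n)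
    {ρ : Matrix (Fin d) (Fin d) ℂ} (hρ : IsState ρ) {Ω : Type*} [MeasurableSpace Ω]
    {P : Measure Ω} [IsProbabilityMeasure P] {v : Fin n → Ω → Sphere d}
    (hv : IsUniformPOVMSample ρ P v) {ρhat : Ω → Matrix (Fin d) (Fin d) ℂ}
    (hhat : ∀ ω, IsPLSEstimator (fun i => v i ω) (ρhat ω)) {t : ℝ} (ht : 0 < t) :
    P.real {ω | (min ρ.rank (ρhat ω).rank : ℕ) * t ≤ traceNorm (ρhat ω - ρ)} ≤
      Real.exp (2.2 * d - t ^ 2 * n / 480) := by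
  obtain _ | d := d
  · have := hρ.2
    simp [Matrix.trace] at this
  have hrank : ∀ ω, (1 : ℝ) ≤ (min ρ.rank (ρhat ω).rank : ℕ) := by
    intro ω
    obtain ⟨L, -, hproj⟩ := hhat ω
    exact_mod_cast Nat.one_le_iff_ne_zero.2
      (Nat.pos_iff_ne_zero.1 (lt_min hρ.rank_pos hproj.1.rank_pos))
  -- For t ≤ 2 the operator-norm threshold τ = t/4 is at most 1/2, and 480 = 16 · 30. For t > 2 the
  -- event is empty, as the ranks are at least 1.
  rcases le_or_gt t 2 with ht2 | ht2
  · have hexp : t ^ 2 * n / 480 = (n * (t / 4) ^ 2) / 30 := by ring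
    rw [hexp]
    refine exp_bound measureReal_le_one ?_
    obtain ⟨s, hs1, hs2, hs⟩ := exists_deviation_net d n hn
    have hsub : {ω | (min ρ.rank (ρhat ω).rank : ℕ) * t ≤ traceNorm (ρhat ω - ρ)} ⊆
        ⋃ y ∈ s, {ω | 7 / 8 * (t / 4) ≤ |deviation ρ (fun i => v i ω) y|} := by
      intro ω hω
      obtain ⟨m, hm0, hm, y, hy, hmy⟩ := hs ρ hρ _ _ (hhat ω)
      have h1 : t ≤ 4 * m :=
        le_of_mul_le_mul_left (le_trans hω hm) (zero_lt_one.trans_le (hrank ω))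
      simp only [Set.mem_iUnion]
      refine ⟨y, hy, le_trans ?_ hmy⟩
      linarith
    calc _ ≤ _ := measureReal_mono hsub (measure_ne_top _ _)
      _ ≤ _ := measureReal_biUnion_finset_le _ _
      _ ≤ ∑ y ∈ s, 2 * Real.exp (-(49 / 512 * (n * (t / 4) ^ 2))) :=
        Finset.sum_le_sum fun y hy =>
          measureReal_le_abs_deviation_le hn hρ hv (hs1 y hy) (by positivity) (by linarith)
      _ = s.card * (2 * Real.exp (-(49 / 512 * (n * (t / 4) ^ 2)))) := by
        rw [Finset.sum_const, nsmul_eq_mul]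
      _ ≤ _ := by
        gcongr
        exact_mod_cast hs2
  · have hempty : {ω | (min ρ.rank (ρhat ω).rank : ℕ) * t ≤ traceNorm (ρhat ω - ρ)} = ∅ := by
      refine Set.eq_empty_of_forall_notMem fun ω hω => ?_
      obtain ⟨L, -, hproj⟩ := hhat ω
      have h1 := traceNorm_sub_le_two hproj.1 hρ
      have h2 : (min ρ.rank (ρhat ω).rank : ℕ) * t ≤ traceNorm (ρhat ω - ρ) := hω
      nlinarith [hrank ω]
    rw [hempty, measureReal_empty]
    positivity

/-- With t = ε/r, the rank cap puts this event inside the one with the random rank. -/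
theorem measureReal_le_traceNorm_and_rank_le {d n : ℕ} (hn : 0 < n)
    {ρ : Matrix (Fin d) (Fin d) ℂ} (hρ : IsState ρ) {Ω : Type*} [MeasurableSpace Ω]
    {P : Measure Ω} [IsProbabilityMeasure P] {v : Fin n → Ω → Sphere d}
    (hv : IsUniformPOVMSample ρ P v) {ρhat : Ω → Matrix (Fin d) (Fin d) ℂ}
    (hhat : ∀ ω, IsPLSEstimator (fun i => v i ω) (ρhat ω)) {ε : ℝ} {r : ℕ} (hε : 0 < ε)
    (hr : 0 < r) :
    P.real {ω | ε ≤ traceNorm (ρhat ω - ρ) ∧ min ρ.rank (ρhat ω).rank ≤ r} ≤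
      Real.exp (2.2 * d - ε ^ 2 * n / (480 * r ^ 2)) := by
  have hr' : (0 : ℝ) < r := by exact_mod_cast hr
  have hexp : ε ^ 2 * n / (480 * r ^ 2) = (ε / r) ^ 2 * n / 480 := by field_simp
  rw [hexp]
  refine (measureReal_mono ?_).trans
    (measureReal_rank_mul_le_traceNorm_le hn hρ hv hhat (div_pos hε hr'))
  rintro ω ⟨h1, h2⟩
  have h2' : ((min ρ.rank (ρhat ω).rank : ℕ) : ℝ) ≤ r := by exact_mod_cast h2
  calc ((min ρ.rank (ρhat ω).rank : ℕ) : ℝ) * (ε / r) ≤ r * (ε / r) := by gcongr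
    _ = ε := by field_simp
    _ ≤ _ := h1

end PLS

end

/-! ### Tail bounds and sampling rate -/

theorem theorem2 :
    (∀ (d n : ℕ) (_ : 0 < n) (ρ : Matrix (Fin d) (Fin d) ℂ) (_ : PLS.IsState ρ)
      (Ω : Type*) [MeasurableSpace Ω] (P : Measure Ω) [IsProbabilityMeasure P]
      (v : Fin n → Ω → PLS.Sphere d) (_ : PLS.IsUniformPOVMSample ρ P v)
      (ρhat : Ω → Matrix (Fin d) (Fin d) ℂ)
      (_ : ∀ ω, PLS.IsPLSEstimator (fun i => v i ω) (ρhat ω)),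
      -- the bound with the random rank `min {rank ρ, rank ρhat}` inside the event
      (∀ t : ℝ, 0 < t →
        P.real {ω | (min ρ.rank (ρhat ω).rank : ℕ) * t ≤ PLS.traceNorm (ρhat ω - ρ)} ≤
          Real.exp (2.2 * d - t ^ 2 * n / 480)) ∧
      -- the bound at a fixed accuracy, on the event that the rank is at most `r`
      (∀ (ε : ℝ) (r : ℕ), 0 < ε → 0 < r →
        P.real {ω | ε ≤ PLS.traceNorm (ρhat ω - ρ) ∧ min ρ.rank (ρhat ω).rank ≤ r} ≤
          Real.exp (2.2 * d - ε ^ 2 * n / (480 * r ^ 2)))) ∧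
    -- the sampling rate
    (∃ C : ℝ, 0 < C ∧
      ∀ (d n : ℕ) (ρ : Matrix (Fin d) (Fin d) ℂ) (_ : PLS.IsState ρ)
        (Ω : Type*) [MeasurableSpace Ω] (P : Measure Ω) [IsProbabilityMeasure P]
        (v : Fin n → Ω → PLS.Sphere d) (_ : PLS.IsUniformPOVMSample ρ P v)
        (ρhat : Ω → Matrix (Fin d) (Fin d) ℂ)
        (_ : ∀ ω, PLS.IsPLSEstimator (fun i => v i ω) (ρhat ω))
        (ε δ : ℝ), 0 < ε → 0 < δ → δ ≤ 1 / 2 →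
        C * (ρ.rank ^ 2 * d / ε ^ 2) * Real.log (1 / δ) ≤ n →
        1 - δ ≤ P.real {ω | PLS.traceNorm (ρhat ω - ρ) ≤ ε}) := by
  refine ⟨fun d n hn ρ hρ Ω _ P _ v hv ρhat hhat =>
    ⟨fun t ht => PLS.measureReal_rank_mul_le_traceNorm_le hn hρ hv hhat ht,
      fun ε r hε hr => PLS.measureReal_le_traceNorm_and_rank_le hn hρ hv hhat hε hr⟩,
    2400, by norm_num, fun d n ρ hρ Ω _ P _ v hv ρhat hhat ε δ hε hδ hδ2 hC => ?_⟩
  have hd : 0 < d := by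
    rcases Nat.eq_zero_or_pos d with rfl | hd
    · have := hρ.2
      simp [Matrix.trace] at this
    · exact hd
  have hd1 : (1 : ℝ) ≤ d := by exact_mod_cast hd
  have hr := hρ.rank_pos
  have hr' : (0 : ℝ) < ρ.rank := by exact_mod_cast hr
  have hlog : Real.log 2 ≤ Real.log (1 / δ) := by
    apply Real.log_le_log (by norm_num)
    rw [le_div_iff₀ hδ]
    linarith
  have hl2 := Real.log_two_gt_d9
  set l := Real.log (1 / δ) with hl
  have hlpos : 0 < l := by linarith
  have hn : 0 < n := by
    have : (0 : ℝ) < n := lt_of_lt_of_le (by positivity) hC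
    exact_mod_cast this
  -- The choice r = rank ρ makes the rank condition automatic.
  have hbad := PLS.measureReal_le_traceNorm_and_rank_le hn hρ hv hhat hε hr
  have hexp : Real.exp (2.2 * d - ε ^ 2 * n / (480 * (ρ.rank : ℝ) ^ 2)) ≤ δ := by
    have h1 : δ = Real.exp (-l) := by
      rw [hl, one_div, Real.log_inv, neg_neg, Real.exp_log hδ]
    rw [h1]
    gcongr
    -- Here 2400 = 5 · 480. Since l > 0.69, four of the five terms dl absorb 2.2d, and the fifth is
    -- at least l.
    have h2 : 5 * (d * l) ≤ ε ^ 2 * n / (480 * (ρ.rank : ℝ) ^ 2) := by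
      rw [le_div_iff₀ (by positivity)]
      calc 5 * (d * l) * (480 * (ρ.rank : ℝ) ^ 2) =
            ε ^ 2 * (2400 * (ρ.rank ^ 2 * d / ε ^ 2) * l) := by field_simp; norm_num
        _ ≤ _ := by gcongr
    have h3 : l ≤ d * l := le_mul_of_one_le_left hlpos.le hd1
    have h4 : (d : ℝ) * 0.69 ≤ d * l := by gcongr; linarith
    linarith
  have hcover : (Set.univ : Set Ω) ⊆ {ω | PLS.traceNorm (ρhat ω - ρ) ≤ ε} ∪
      {ω | ε ≤ PLS.traceNorm (ρhat ω - ρ) ∧ min ρ.rank (ρhat ω).rank ≤ ρ.rank} := by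
    intro ω _
    rcases le_total (PLS.traceNorm (ρhat ω - ρ)) ε with h | h
    · exact Or.inl h
    · exact Or.inr ⟨h, min_le_left _ _⟩
  have h1 := (measureReal_mono (μ := P) hcover).trans (measureReal_union_le _ _)
  rw [probReal_univ] at h1
  linarith
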